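/- Let $d,m\ge 1$, $\mathbb{T}^d=\mathbb{R}^d/\mathbb{Z}^d$, $2\mathbb{T}^d=\mathbb{R}^d/2\mathbb{Z}^d$, and let $\alpha\in\mathbb{R}^d$ be such that the translation $\theta\mapsto\theta+\alpha$ of $\mathbb{T}^d$ is ergodic for Lebesgue measure. Let $J=\begin{pmatrix}0&I_m\\-I_m&0\end{pmatrix}$ and $\mathrm{HSp}(2m,\mathbb{C})=\{M\in \mathrm{GL}(2m,\mathbb{C}): M^*JM=J\}$. *Rotation number.* For a Lagrangian subspace $\Lambda$ of $\mathbb{C}^{2m}$ with frame $\begin{pmatrix}X\\Y\end{pmatrix}$ (that is, $X^*Y=Y^*X$ and the frame has rank $m$) put $W_\Lambda=(X+iY)(X-iY)^{-1}\in \mathbf{U}(m)$. A continuous $A:\mathbb{T}^d\to\mathrm{HSp}(2m,\mathbb{C})$ acts on $\mathbb{T}^d\times\mathbf{U}(m)$ by $(\theta,W_\Lambda)\mapsto(\theta+\alpha,W_{A(\theta)\Lambda})$. A lift of $(\alpha,A)$ is a continuous map $\tilde F$ of $\mathbb{T}^d\times\mathbb{R}\times\mathbf{SU}(m)$ to itself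 which covers this action under $(\theta,x,S)\mapsto(\theta,e^{2\pi i x}S)$ and whose displacement $f(\theta,x,S)=m\,(p_2\tilde F(\theta,x,S)-x)$, where $p_2$ is the projection to $\mathbb{R}$, depends only on $(\theta,e^{2\pi i x}S)$. The fibered rotation number $\mathrm{rot}_f(\alpha,A)\in\mathbb{R}/\mathbb{Z}$ is the class modulo $\mathbb{Z}$ of $$\lim_{n\to\infty}\frac1n\sum_{k=0}^{n-1}f\bigl(\tilde F^k(\theta,x,S)\bigr);$$ it is said to be well defined if a lift exists and if, for every lift, the limit exists and is the same real number for almost every $\theta$ and all $(x,S)$, its class not depending on the lift. *Degree.* Let $\mathcal{C}=\frac{1}{\sqrt{2i}}\begin{pmatrix}I_m&-iI_m\\I_m&iI_m\end{pmatrix}$. For continuous $B:\mathbb{T}^d\to\mathrm{HSp}(2m,\mathbb{C})$, let $\mathcal{C}B(\theta)\mathcal{C}^{-1}=P(\theta)\begin{pmatrix}U_1(\theta)&0\\0&U_2(\theta)\end{pmatrix}$ be the polar decomposition in $\mathbf{U}(m,m)$, with $P(\theta)$ Hermitian positive definite and $U_1(\theta),U_2(\theta)\in\mathbf{U}(m)$.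 Then $B$ has degree $r\in\mathbb{Z}^d$ if $\theta\mapsto\det(U_1(\theta)^{-1}U_2(\theta))$ is homotopic to $\theta\mapsto e^{2\pi i\langle r,\theta\rangle}$ as a map $\mathbb{T}^d\to S^1$. **Proposition.** Let $A:\mathbb{T}^d\to\mathrm{HSp}(2m,\mathbb{C})$ be continuous and homotopic to the constant map $I_{2m}$. Then $\mathrm{rot}_f(\alpha,A)$ is well defined, and the following hold. 1. If $B:\mathbb{T}^d\to\mathrm{HSp}(2m,\mathbb{C})$ is continuous of degree $r\in\mathbb{Z}^d$, then the rotation number of $(\alpha,\;B(\cdot+\alpha)^{-1}A(\cdot)B(\cdot))$ is well defined and $$\mathrm{rot}_f\bigl(\alpha,\;B(\cdot+\alpha)^{-1}A(\cdot)B(\cdot)\bigr)=\mathrm{rot}_f(\alpha,A)-\langle r,\alpha\rangle \mod \mathbb{Z}.$$ 2. If $B:2\mathbb{T}^d\to\mathrm{HSp}(2m,\mathbb{C})$ is continuous, the map $\theta\mapsto B(2\theta)$ on $\mathbb{T}^d$ has degree $r\in\mathbb{Z}^d$, and $B(\cdot+\alpha)^{-1}A(\cdot)B(\cdot)$ is well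 defined as a continuous map on $\mathbb{T}^d$, then the rotation number of $(\alpha,\;B(\cdot+\alpha)^{-1}A(\cdot)B(\cdot))$ is well defined and $$\mathrm{rot}_f\bigl(\alpha,\;B(\cdot+\alpha)^{-1}A(\cdot)B(\cdot)\bigr)=\mathrm{rot}_f(\alpha,A)-\frac{\langle r,\alpha\rangle}{2} \mod \mathbb{Z}.$$ -/

import Mathlib

open scoped Matrix ComplexOrder
open MeasureTheory Filter Topology

noncomputable section

namespace HSpCocycle

/-- The torus `(ℝ / pℤ)^d`. `Torus d 1` is `𝕋^d` and `Torus d 2` is `2𝕋^d`. -/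
abbrev Torus (d : ℕ) (p : ℝ) : Type := Fin d → AddCircle p

/-- The projection `ℝ^d → (ℝ / pℤ)^d`. -/
def toTorus {d : ℕ} (p : ℝ) (x : Fin d → ℝ) : Torus d p := fun i => (x i : AddCircle p)

/-- The Hermitian symplectic group `HSp(2m, ℂ) = {M ∈ GL(2m, ℂ) : M* J M = J}`. -/
def HSp (m : ℕ) : Subgroup (GL (Fin m ⊕ Fin m) ℂ) where
  carrier := {M | (M : Matrix (Fin m ⊕ Fin m) (Fin m ⊕ Fin m) ℂ)ᴴ * Matrix.J (Fin m) ℂ *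
    (M : Matrix (Fin m ⊕ Fin m) (Fin m ⊕ Fin m) ℂ) = Matrix.J (Fin m) ℂ}
  one_mem' := by simp
  mul_mem' := by
    intro a b ha hb
    simp only [Set.mem_ofPred_eq, Units.val_mul, Matrix.conjTranspose_mul] at ha hb ⊢
    calc _ = (b : Matrix (Fin m ⊕ Fin m) (Fin m ⊕ Fin m) ℂ)ᴴ *
          ((a : Matrix (Fin m ⊕ Fin m) (Fin m ⊕ Fin m) ℂ)ᴴ * Matrix.J (Fin m) ℂ * a) * b := by
            simp only [Matrix.mul_assoc]
      _ = _ := by rw [ha, hb]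
  inv_mem' := by
    intro a ha
    simp only [Set.mem_ofPred_eq] at ha ⊢
    have h1 : (a : Matrix (Fin m ⊕ Fin m) (Fin m ⊕ Fin m) ℂ) *
        ((a⁻¹ : GL (Fin m ⊕ Fin m) ℂ) : Matrix (Fin m ⊕ Fin m) (Fin m ⊕ Fin m) ℂ) = 1 :=
      Units.mul_inv a
    have h2 := congrArg Matrix.conjTranspose h1
    rw [Matrix.conjTranspose_mul, Matrix.conjTranspose_one] at h2
    calc _ = ((a⁻¹ : GL (Fin m ⊕ Fin m) ℂ) : Matrix (Fin m ⊕ Fin m) (Fin m ⊕ Fin m) ℂ)ᴴ *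
          ((a : Matrix (Fin m ⊕ Fin m) (Fin m ⊕ Fin m) ℂ)ᴴ * Matrix.J (Fin m) ℂ * a) *
          ((a⁻¹ : GL (Fin m ⊕ Fin m) ℂ) : Matrix (Fin m ⊕ Fin m) (Fin m ⊕ Fin m) ℂ) := by
            rw [ha]
      _ = (((a⁻¹ : GL (Fin m ⊕ Fin m) ℂ) : Matrix (Fin m ⊕ Fin m) (Fin m ⊕ Fin m) ℂ)ᴴ *
          (a : Matrix (Fin m ⊕ Fin m) (Fin m ⊕ Fin m) ℂ)ᴴ) * Matrix.J (Fin m) ℂ *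
          ((a : Matrix (Fin m ⊕ Fin m) (Fin m ⊕ Fin m) ℂ) *
          ((a⁻¹ : GL (Fin m ⊕ Fin m) ℂ) : Matrix (Fin m ⊕ Fin m) (Fin m ⊕ Fin m) ℂ)) := by
            simp only [Matrix.mul_assoc]
      _ = _ := by rw [h2, h1]; simp

/-- The underlying matrix of an element of `HSp(2m, ℂ)`. -/
def hspMatrix {m : ℕ} (M : HSp m) : Matrix (Fin m ⊕ Fin m) (Fin m ⊕ Fin m) ℂ :=
  ((M : GL (Fin m ⊕ Fin m) ℂ) : Matrix (Fin m ⊕ Fin m) (Fin m ⊕ Fin m) ℂ)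

/-- `L = (X; Y)` is a Lagrangian frame: `X* Y = Y* X` and `rank L = m`. A Lagrangian subspace of
`ℂ^{2m}` is the column space of such an `L`, and `M ∈ HSp(2m, ℂ)` acts on frames by `L ↦ M L`. -/
def IsLagrangianFrame {m : ℕ} (L : Matrix (Fin m ⊕ Fin m) (Fin m) ℂ) : Prop :=
  L.toRows₁ᴴ * L.toRows₂ = L.toRows₂ᴴ * L.toRows₁ ∧ L.rank = m

/-- `W_Λ = (X + iY)(X - iY)⁻¹`, for the Lagrangian subspace `Λ` with frame `L = (X; Y)`. -/
def lagW {m : ℕ} (L : Matrix (Fin m ⊕ Fin m) (Fin m) ℂ) : Matrix (Fin m) (Fin m) ℂ :=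
  (L.toRows₁ + Complex.I • L.toRows₂) * (L.toRows₁ - Complex.I • L.toRows₂)⁻¹

/-- The covering `ℝ × SU(m) → U(m)`, `(x, S) ↦ e^{2πix} S`. -/
def unitaryCover {m : ℕ} (x : ℝ) (S : Matrix.specialUnitaryGroup (Fin m) ℂ) :
    Matrix (Fin m) (Fin m) ℂ :=
  Complex.exp (2 * Real.pi * Complex.I * x) • (S : Matrix (Fin m) (Fin m) ℂ)

/-- The covering space `𝕋^d × ℝ × SU(m)` of `𝕋^d × U(m)`. -/
abbrev CoverSpace (d m : ℕ) : Type := Torus d 1 × ℝ × Matrix.specialUnitaryGroup (Fin m) ℂ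

/-- `F` is a lift, to `𝕋^d × ℝ × SU(m)`, of the map `(θ, W_Λ) ↦ (θ + α, W_{A(θ)Λ})` of
`𝕋^d × U(m)` to itself. -/
structure IsLift {d m : ℕ} (α : Fin d → ℝ) (A : C(Torus d 1, HSp m))
    (F : CoverSpace d m → CoverSpace d m) : Prop where
  continuous : Continuous F
  base : ∀ θ x S, (F (θ, x, S)).1 = θ + toTorus 1 α
  covers : ∀ θ x S, ∀ L : Matrix (Fin m ⊕ Fin m) (Fin m) ℂ, IsLagrangianFrame L →
    unitaryCover x S = lagW L →
    unitaryCover (F (θ, x, S)).2.1 (F (θ, x, S)).2.2 = lagW (hspMatrix (A θ) * L)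
  descends : ∀ θ x S x' S', unitaryCover x S = unitaryCover (m := m) x' S' →
    (F (θ, x, S)).2.1 - x = (F (θ, x', S')).2.1 - x'

/-- The displacement `f(θ, x, S) = m (p₂(F(θ, x, S)) - x)` of a lift. -/
def displacement {d m : ℕ} (F : CoverSpace d m → CoverSpace d m) (q : CoverSpace d m) : ℝ :=
  m * ((F q).2.1 - q.2.1)

/-- `rot_f(α, A) = ρ` in `ℝ / ℤ`: the cocycle `(α, A)` has a lift, and for every lift the Birkhoff
averages of its displacement converge, for almost every `θ` and all `(x, S)`, to one and the same
real number, whose class is `ρ`. -/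
def IsFiberedRotationNumber {d m : ℕ} (α : Fin d → ℝ) (A : C(Torus d 1, HSp m))
    (ρ : UnitAddCircle) : Prop :=
  (∃ F, IsLift α A F) ∧
  ∀ F, IsLift α A F → ∃ t : ℝ, (t : UnitAddCircle) = ρ ∧
    ∀ᵐ θ ∂(volume : Measure (UnitAddTorus (Fin d))),
      ∀ (x : ℝ) (S : Matrix.specialUnitaryGroup (Fin m) ℂ),
        Tendsto (fun n : ℕ => birkhoffAverage ℝ F (displacement F) n (θ, x, S)) atTop (𝓝 t)

/-- The cocycle map `B(θ + α)⁻¹ A(θ) B(θ)` of `(0, B)⁻¹ ∘ (α, A) ∘ (0, B)`. -/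
def conjugate {d m : ℕ} (α : Fin d → ℝ) (A B : C(Torus d 1, HSp m)) : C(Torus d 1, HSp m) where
  toFun θ := (B (θ + toTorus 1 α))⁻¹ * A θ * B θ
  continuous_toFun := by fun_prop

/-- The Cayley element `(2i)^{-1/2} (I, -iI; I, iI)`. -/
def cayley (m : ℕ) : Matrix (Fin m ⊕ Fin m) (Fin m ⊕ Fin m) ℂ :=
  ((2 * Complex.I) ^ (1 / 2 : ℂ))⁻¹ •
    Matrix.fromBlocks 1 (-(Complex.I • 1)) 1 (Complex.I • 1)

/-- `P · diag(U₁, U₂)` is the polar decomposition in `U(m, m)` of the Cayley conjugate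
`𝒞 M 𝒞⁻¹` of `M ∈ HSp(2m, ℂ)`. -/
def IsPolar {m : ℕ} (M : HSp m) (P : Matrix (Fin m ⊕ Fin m) (Fin m ⊕ Fin m) ℂ)
    (U₁ U₂ : Matrix.unitaryGroup (Fin m) ℂ) : Prop :=
  P.PosDef ∧
  Pᴴ * Matrix.fromBlocks 1 0 0 (-1) * P = Matrix.fromBlocks 1 0 0 (-1) ∧
  cayley m * hspMatrix M * (cayley m)⁻¹ =
    P * Matrix.fromBlocks (U₁ : Matrix (Fin m) (Fin m) ℂ) 0 0 (U₂ : Matrix (Fin m) (Fin m) ℂ)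

/-- The character `θ ↦ e^{2πi⟨r, θ⟩}` of `𝕋^d`. -/
def character {d : ℕ} (r : Fin d → ℤ) : C(Torus d 1, Circle) where
  toFun θ := ∏ i, (AddCircle.toCircle (θ i)) ^ (r i)
  continuous_toFun :=
    continuous_finsetProd _ fun i _ =>
      (AddCircle.continuous_toCircle.comp (continuous_apply i)).zpow (r i)

/-- `deg B = r`: for the polar decomposition `P(θ) diag(U₁(θ), U₂(θ))` of `𝒞 B(θ) 𝒞⁻¹`, the map
`θ ↦ det(U₁(θ)⁻¹ U₂(θ))` is homotopic to `e^{2πi⟨r, θ⟩}` as a map `𝕋^d → S¹`. The factors of the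
polar decomposition are unique and depend continuously on the matrix. -/
def HasDegree {d m : ℕ} (B : C(Torus d 1, HSp m)) (r : Fin d → ℤ) : Prop :=
  ∃ (P : Torus d 1 → Matrix (Fin m ⊕ Fin m) (Fin m ⊕ Fin m) ℂ)
    (U₁ U₂ : C(Torus d 1, Matrix.unitaryGroup (Fin m) ℂ)) (h : C(Torus d 1, Circle)),
    (∀ θ, IsPolar (B θ) (P θ) (U₁ θ) (U₂ θ)) ∧
    (∀ θ, (h θ : ℂ) =
      (((U₁ θ)⁻¹ * U₂ θ : Matrix.unitaryGroup (Fin m) ℂ) : Matrix (Fin m) (Fin m) ℂ).det) ∧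
    h.Homotopic (character r)

/-- The map `𝕋^d → 2𝕋^d`, `θ ↦ 2θ`. -/
def double (d : ℕ) : C(Torus d 1, Torus d 2) where
  toFun θ := fun i => AddCircle.homeomorphAddCircle 1 2 one_ne_zero two_ne_zero (θ i)
  continuous_toFun := by fun_prop

end HSpCocycle

end

/-! Write the Cayley conjugate of `g` as the block matrix `(a b; c d)` in `U(m,m)`. On `U(m)` the
group acts by `W ↦ (c + d W)(a + b W)⁻¹`, and `det (g W) = det W · (det d / det a) · det (1 + W* d⁻¹
c) / det (1 + a⁻¹ b W)`. The matrices `a⁻¹ b W` and `W* d⁻¹ c` have spectrum in the open unit disk,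
so the last quotient has a continuous argument `E` on all of `HSp × U(m)`, bounded by `2m` turns
(`exists_bounded_arg`). All the topology therefore sits in the phase `kappa g` of `det d / det a`,
which for a polar decomposition equals `det (U₁⁻¹ U₂)` (`IsPolar.kappa_eq`): it is the quantity that
defines the degree.

If `A` is homotopic to the identity, `kappa ∘ A` lifts to `ℝ`, and the determinant cocycle has a
continuous argument `f` on `𝕋^d × U(m)` (`IsAngle`). It produces a lift, and connectedness of the
covering space shows that every lift has displacement `f` plus an integer constant. For fixed `θ`
the `n`-step map is the action of one group element, so the Birkhoff sums of `f` vary with `W` by at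
most a constant independent of `n`. Up to bounded error they are thus functions of `θ`, whose
averages converge at every point by equidistribution of the ergodic rotation; a subadditivity-type
argument (`exists_tendsto_birkhoffAverage`) yields the limit.

For a conjugacy `B`, pulled back to `ℝ^d`, the degree gives `kappa (B x)` the argument `⟨β, x⟩ + u
x` with `u` bounded. The conjugated cocycle then has the angle `f` composed with the conjugacy, plus
a bounded coboundary, minus `⟨β, α⟩`. This function is periodic because it is bounded and its
increments under periods are constant. Both items are the same computation, with `β = r` for `𝕋^d`
and `β = r / 2` for `2𝕋^d`. -/

noncomputable section

namespace HSpCocycle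

/-! ### Circle-valued maps and their real arguments -/

/-- The character `x ↦ e^{2πix}` of `ℝ`. -/
def expTwoPi (x : ℝ) : Circle := Circle.exp (2 * Real.pi * x)

theorem continuous_expTwoPi : Continuous expTwoPi :=
  Circle.exp.continuous.comp (by fun_prop)

theorem coe_expTwoPi (x : ℝ) :
    (expTwoPi x : ℂ) = Complex.exp (2 * Real.pi * Complex.I * x) := by
  rw [expTwoPi, Circle.coe_exp]
  push_cast
  ring_nf

theorem expTwoPi_zero : expTwoPi 0 = 1 := by simp [expTwoPi]

theorem expTwoPi_add (x y : ℝ) : expTwoPi (x + y) = expTwoPi x * expTwoPi y := by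
  simp [expTwoPi, mul_add, Circle.exp_add]

theorem expTwoPi_neg (x : ℝ) : expTwoPi (-x) = (expTwoPi x)⁻¹ := by
  simp [expTwoPi, Circle.exp_neg]

theorem expTwoPi_sub (x y : ℝ) : expTwoPi (x - y) = expTwoPi x / expTwoPi y := by
  rw [sub_eq_add_neg, expTwoPi_add, expTwoPi_neg, div_eq_mul_inv]

theorem expTwoPi_natCast_mul (n : ℕ) (x : ℝ) : expTwoPi (n * x) = expTwoPi x ^ n := by
  induction n with
  | zero => simp [expTwoPi_zero]
  | succ k ih => rw [pow_succ, ← ih, ← expTwoPi_add]; push_cast; ring_nf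

theorem expTwoPi_intCast_mul (n : ℤ) (x : ℝ) : expTwoPi (n * x) = expTwoPi x ^ n := by
  obtain ⟨k, rfl | rfl⟩ := n.eq_nat_or_neg
  · simpa using expTwoPi_natCast_mul k x
  · simpa [expTwoPi_neg] using expTwoPi_natCast_mul k x

theorem expTwoPi_sum {ι : Type*} (s : Finset ι) (f : ι → ℝ) :
    expTwoPi (∑ i ∈ s, f i) = ∏ i ∈ s, expTwoPi (f i) := by
  classical
  induction s using Finset.induction_on with
  | empty => simp [expTwoPi_zero]
  | insert a s ha ih => rw [Finset.sum_insert ha, Finset.prod_insert ha, expTwoPi_add, ih]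

theorem expTwoPi_eq_one_iff (x : ℝ) : expTwoPi x = 1 ↔ ∃ k : ℤ, x = k := by
  have hp : (2 * Real.pi) ≠ 0 := Real.two_pi_pos.ne'
  rw [expTwoPi, Circle.exp_eq_one]
  refine exists_congr fun k => ⟨fun h => ?_, fun h => ?_⟩
  · apply mul_left_cancel₀ hp
    linarith
  · rw [h]; ring

theorem expTwoPi_eq_iff (x y : ℝ) : expTwoPi x = expTwoPi y ↔ ∃ k : ℤ, x = y + k := by
  rw [← div_eq_one, ← expTwoPi_sub, expTwoPi_eq_one_iff]
  exact exists_congr fun k => by rw [sub_eq_iff_eq_add']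

theorem expTwoPi_surjective : Function.Surjective expTwoPi := fun z =>
  ⟨Complex.arg z / (2 * Real.pi), by
    rw [expTwoPi, mul_div_cancel₀ _ Real.two_pi_pos.ne', Circle.exp_arg]⟩

theorem toCircle_eq_expTwoPi (x : ℝ) : AddCircle.toCircle (x : UnitAddCircle) = expTwoPi x := by
  rw [AddCircle.toCircle_apply_mk, expTwoPi, div_one]

/-- Uniqueness of lifts through a covering. It serves to compare two continuous arguments of one
circle-valued map: their difference is integer valued, hence constant on a connected space. -/
theorem eq_of_expTwoPi_comp_const {X : Type*} [TopologicalSpace X] [PreconnectedSpace X]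
    {f : X → ℝ} (hf : Continuous f) (h : ∀ x y, expTwoPi (f x) = expTwoPi (f y)) (x y : X) :
    f x = f y := by
  have h1 := Circle.isCoveringMap_exp.const_of_comp (g := fun x => 2 * Real.pi * f x)
    (by fun_prop) h x y
  exact mul_left_cancel₀ Real.two_pi_pos.ne' h1

/-- Homotopies in the circle lift through `x ↦ e^{2πix}`. -/
theorem exists_lift_homotopy {X : Type*} [TopologicalSpace X] (H : C(unitInterval × X, Circle))
    (f : C(X, ℝ)) (h0 : ∀ x, H (0, x) = expTwoPi (f x)) :
    ∃ G : C(unitInterval × X, ℝ), (∀ p, H p = expTwoPi (G p)) ∧ ∀ x, G (0, x) = f x := by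
  have h1 : ∀ x, H (0, x) = Circle.exp ((⟨fun x => 2 * Real.pi * f x, by fun_prop⟩ : C(X, ℝ)) x) :=
    h0
  refine ⟨⟨fun p => Circle.isCoveringMap_exp.liftHomotopy H _ h1 p / (2 * Real.pi), by fun_prop⟩,
    fun p => ?_, fun x => ?_⟩
  · have := congrFun (Circle.isCoveringMap_exp.liftHomotopy_lifts H _ h1) p
    simp only [ContinuousMap.coe_mk, expTwoPi]
    rw [mul_div_cancel₀ _ Real.two_pi_pos.ne', ← this]
    rfl
  · have := Circle.isCoveringMap_exp.liftHomotopy_zero H _ h1 x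
    simp only [ContinuousMap.coe_mk] at this ⊢
    rw [this, mul_div_cancel_left₀ _ Real.two_pi_pos.ne']

theorem exists_lift_of_homotopic_lift {X : Type*} [TopologicalSpace X] {g h : C(X, Circle)}
    (hgh : g.Homotopic h) (f : C(X, ℝ)) (hf : ∀ x, g x = expTwoPi (f x)) :
    ∃ k : C(X, ℝ), ∀ x, h x = expTwoPi (k x) := by
  obtain ⟨H⟩ := hgh
  obtain ⟨G, hG, -⟩ := exists_lift_homotopy H.toContinuousMap f fun x => by
    rw [← hf]; exact H.map_zero_left x
  refine ⟨⟨fun x => G (1, x), by fun_prop⟩, fun x => ?_⟩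
  exact (H.map_one_left x).symm.trans (hG (1, x))

/-! ### Phases and bounded arguments of `det (1 + K)` -/

/-- The phase `z / |z|` of a nonzero complex number. -/
def phase (z : ℂ) : Circle := Circle.exp z.arg

theorem coe_phase {z : ℂ} (hz : z ≠ 0) : (phase z : ℂ) = z / ‖z‖ := by
  rw [phase, Circle.coe_exp, eq_div_iff (by simpa using hz), mul_comm]
  exact Complex.norm_mul_exp_arg_mul_I z

theorem phase_mul {z w : ℂ} (hz : z ≠ 0) (hw : w ≠ 0) : phase (z * w) = phase z * phase w := by
  apply Circle.ext
  rw [Circle.coe_mul, coe_phase hz, coe_phase hw, coe_phase (mul_ne_zero hz hw), norm_mul]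
  push_cast
  rw [mul_div_mul_comm]

theorem phase_div {z w : ℂ} (hz : z ≠ 0) (hw : w ≠ 0) : phase (z / w) = phase z / phase w := by
  rw [eq_div_iff_mul_eq', ← phase_mul (div_ne_zero hz hw) hw, div_mul_cancel₀ _ hw]

theorem phase_of_pos {z : ℂ} (hz : 0 < z) : phase z = 1 := by
  rw [phase, Complex.arg_eq_zero_iff_zero_le.mpr hz.le, Circle.exp_zero]

theorem continuous_phase_comp {X : Type*} [TopologicalSpace X] {f : X → ℂ} (hf : Continuous f)
    (h0 : ∀ x, f x ≠ 0) : Continuous fun x => phase (f x) := by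
  refine continuous_induced_rng.mpr ?_
  have : ((fun z : Circle => (z : ℂ)) ∘ fun x => phase (f x)) = fun x => f x / ‖f x‖ :=
    funext fun x => coe_phase (h0 x)
  refine (this ▸ ?_ : Continuous ((fun z : Circle => (z : ℂ)) ∘ fun x => phase (f x)))
  exact hf.div (by fun_prop) fun x => by simpa using h0 x

theorem expTwoPi_arg_div (z : ℂ) : expTwoPi (z.arg / (2 * Real.pi)) = phase z := by
  rw [expTwoPi, mul_div_cancel₀ _ Real.two_pi_pos.ne', phase]

/-- For `t ≠ 0` this is the characteristic polynomial evaluated at `-1/t`. It reduces the argument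
of the determinant to the eigenvalues, counted with multiplicity. -/
theorem det_one_add_smul_eq_prod {n : Type*} [Fintype n] [DecidableEq n] (K : Matrix n n ℂ)
    (t : ℂ) : (1 + t • K).det = (K.charpoly.roots.map fun z => 1 + t * z).prod := by
  have hc : K.charpoly.roots.card = Fintype.card n := by
    rw [← (IsAlgClosed.splits K.charpoly).natDegree_eq_card_roots, K.charpoly_natDegree_eq_dim]
  rcases eq_or_ne t 0 with rfl | ht
  · simp
  have h1 : K.charpoly.eval (-t⁻¹) = (K.charpoly.roots.map fun z => -t⁻¹ - z).prod := by
    conv_lhs => rw [(IsAlgClosed.splits K.charpoly).eq_prod_roots_of_monic K.charpoly_monic]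
    simp [Polynomial.eval_multiset_prod, Multiset.map_map]
  rw [Matrix.eval_charpoly] at h1
  have h2 : 1 + t • K = (-t) • (Matrix.scalar n (-t⁻¹) - K) := by
    rw [smul_sub, Matrix.scalar_apply, ← Matrix.smul_one_eq_diagonal, smul_smul]
    simp [ht]
  have h3 : (K.charpoly.roots.map fun z => 1 + t * z) =
      K.charpoly.roots.map fun z => -t * (-t⁻¹ - z) :=
    Multiset.map_congr rfl fun z _ => by field_simp; ring
  rw [h2, Matrix.det_smul, h1, h3, Multiset.prod_map_mul, Multiset.map_const',
    Multiset.prod_replicate, hc]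

theorem one_add_mul_mem_slitPlane {z : ℂ} (hz : ‖z‖ < 1) (t : unitInterval) :
    1 + ((t : ℝ) : ℂ) * z ∈ Complex.slitPlane := by
  refine Complex.mem_slitPlane_iff.mpr (Or.inl ?_)
  have h1 : |z.re| < 1 := (Complex.abs_re_le_norm z).trans_lt hz
  have h2 := abs_lt.mp h1
  have := t.2.1
  have := t.2.2
  simp only [Complex.add_re, Complex.one_re, Complex.mul_re, Complex.ofReal_re, Complex.ofReal_im,
    zero_mul, sub_zero]
  nlinarith

/-- A bounded continuous argument of `∏ (1 + t z)` for `0 ≤ t ≤ 1`, when all `|z| < 1`. -/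
theorem exists_arg_prod_one_add (s : Multiset ℂ) (hs : ∀ z ∈ s, ‖z‖ < 1) :
    ∃ σ : C(unitInterval, ℝ), σ 0 = 0 ∧ (∀ t, |σ t| ≤ s.card) ∧ ∀ t : unitInterval,
      (s.map fun z => 1 + ((t : ℝ) : ℂ) * z).prod ≠ 0 ∧
      phase (s.map fun z => 1 + ((t : ℝ) : ℂ) * z).prod = expTwoPi (σ t) := by
  induction s using Multiset.induction_on with
  | empty =>
    exact ⟨0, by simp, by simp, fun t => by simp [expTwoPi_zero, phase_of_pos one_pos]⟩
  | cons a s ih =>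
    obtain ⟨σ, h0, hb, hp⟩ := ih fun z hz => hs z (Multiset.mem_cons_of_mem hz)
    have ha := one_add_mul_mem_slitPlane (hs a (Multiset.mem_cons_self a s))
    -- The argument is a sum of principal arguments; each is continuous because `1 + t a` has
    -- positive real part and so avoids the cut. Each contributes at most one turn, a crude bound
    -- that suffices.
    refine ⟨⟨fun t => (1 + ((t : ℝ) : ℂ) * a).arg / (2 * Real.pi) + σ t, ?_⟩, ?_, fun t => ?_,
      fun t => ?_⟩
    · refine Continuous.add (Continuous.div_const ?_ _) σ.continuous
      exact continuous_iff_continuousAt.mpr fun t =>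
        (Complex.continuousAt_arg (ha t)).comp (f := fun t : unitInterval => 1 + ((t : ℝ) : ℂ) * a)
          (by fun_prop)
    · simp [h0]
    · have h1 := Complex.abs_arg_le_pi (1 + ((t : ℝ) : ℂ) * a)
      have h2 : |(1 + ((t : ℝ) : ℂ) * a).arg / (2 * Real.pi)| ≤ 1 := by
        rw [abs_div, abs_of_pos Real.two_pi_pos, div_le_one Real.two_pi_pos]
        linarith [Real.pi_pos]
      have h3 := hb t
      simp only [ContinuousMap.coe_mk, Multiset.card_cons]
      push_cast
      exact (abs_add_le _ _).trans (by linarith)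
    · obtain ⟨h1, h2⟩ := hp t
      have h3 := Complex.slitPlane_ne_zero (ha t)
      rw [Multiset.map_cons, Multiset.prod_cons]
      refine ⟨mul_ne_zero h3 h1, ?_⟩
      rw [phase_mul h3 h1, h2]
      simp only [ContinuousMap.coe_mk]
      rw [expTwoPi_add, expTwoPi_arg_div]

theorem det_one_add_ne_zero {n : Type*} [Fintype n] [DecidableEq n] {K : Matrix n n ℂ}
    (hK : ∀ z ∈ K.charpoly.roots, ‖z‖ < 1) (t : unitInterval) :
    (1 + ((t : ℝ) : ℂ) • K).det ≠ 0 := by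
  obtain ⟨_, _, _, h⟩ := exists_arg_prod_one_add _ hK
  rw [det_one_add_smul_eq_prod]
  exact (h t).1

/-- A bounded continuous argument of `det (1 + K)`, for `K` with spectrum in the open unit disk. -/
theorem exists_arg_det_one_add {X n : Type*} [TopologicalSpace X] [Fintype n] [DecidableEq n]
    {K : X → Matrix n n ℂ} (hK : Continuous K)
    (hs : ∀ x, ∀ z ∈ (K x).charpoly.roots, ‖z‖ < 1) :
    ∃ ε : C(X, ℝ), (∀ x, |ε x| ≤ Fintype.card n) ∧
      ∀ x, phase (1 + K x).det = expTwoPi (ε x) := by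
  -- The deformation `t K` contracts the determinant to `1`, whose argument is `0`. Lifting this
  -- homotopy gives an argument continuous in `x`, with no need to follow the eigenvalues
  -- continuously.
  let H : C(unitInterval × X, Circle) :=
    ⟨fun p => phase (1 + ((p.1 : ℝ) : ℂ) • K p.2).det, continuous_phase_comp (by fun_prop)
      fun p => det_one_add_ne_zero (hs p.2) p.1⟩
  obtain ⟨G, hG, hG0⟩ := exists_lift_homotopy H 0 fun x => by
    simp [H, expTwoPi_zero, phase_of_pos one_pos]
  refine ⟨⟨fun x => G (1, x), by fun_prop⟩, fun x => ?_, fun x => ?_⟩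
  · obtain ⟨σ, h0, hb, hp⟩ := exists_arg_prod_one_add _ (hs x)
    have h1 : ∀ t, expTwoPi (G (t, x)) = expTwoPi (σ t) := fun t => by
      rw [← hG, ← (hp t).2, ← det_one_add_smul_eq_prod]
      rfl
    -- Along the segment over a fixed `x`, the lift and the eigenvalue-wise argument `σ` both start
    -- at `0`, so they agree; the bound on `σ` passes to the lift.
    have h2 := eq_of_expTwoPi_comp_const (f := fun t => G (t, x) - σ t) (by fun_prop)
      (fun s t => by simp [expTwoPi_sub, h1]) 1 0
    have hc : (K x).charpoly.roots.card = Fintype.card n := by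
      rw [← (IsAlgClosed.splits (K x).charpoly).natDegree_eq_card_roots,
        (K x).charpoly_natDegree_eq_dim]
    have h3 : G (1, x) = σ 1 := by
      simp only [hG0, h0, ContinuousMap.zero_apply] at h2
      linarith
    rw [ContinuousMap.coe_mk, h3, ← hc]
    exact hb 1
  · simpa [H] using hG (1, x)

/-! ### Strict contractions -/

section Disk

variable {n : Type*} [Fintype n] [DecidableEq n]

/-- Pairing `1 - K K*` with a left eigenvector `v` of `K` for the eigenvalue `z` gives `(1 -
|z|²)|v|² = |v P|²`, which is positive as `P` is invertible. -/
theorem norm_lt_one_of_mem_roots_charpoly {K P : Matrix n n ℂ} (hP : P.det ≠ 0)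
    (h : 1 - K * Kᴴ = P * Pᴴ) : ∀ z ∈ K.charpoly.roots, ‖z‖ < 1 := by
  intro z hz
  have h1 := (Polynomial.mem_roots'.mp hz).2
  rw [Polynomial.IsRoot.def, Matrix.eval_charpoly] at h1
  obtain ⟨v, hv, hv0⟩ := Matrix.exists_vecMul_eq_zero_iff.mpr h1
  rw [Matrix.vecMul_sub, sub_eq_zero, Matrix.scalar_apply, ← Matrix.smul_one_eq_diagonal,
    Matrix.vecMul_smul, Matrix.vecMul_one] at hv0
  have h2 : v ⬝ᵥ ((1 - K * Kᴴ) *ᵥ star v) = (1 - z * star z) * (v ⬝ᵥ star v) := by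
    rw [Matrix.sub_mulVec, Matrix.one_mulVec, dotProduct_sub, ← Matrix.mulVec_mulVec,
      Matrix.dotProduct_mulVec, ← hv0, ← Matrix.star_vecMul, ← hv0, star_smul, smul_dotProduct,
      dotProduct_smul]
    simp only [smul_eq_mul]
    ring
  have h3 : v ⬝ᵥ ((P * Pᴴ) *ᵥ star v) = (v ᵥ* P) ⬝ᵥ star (v ᵥ* P) := by
    rw [← Matrix.mulVec_mulVec, Matrix.dotProduct_mulVec, ← Matrix.star_vecMul]
  have h4 : v ᵥ* P ≠ 0 := fun h0 => hP (Matrix.exists_vecMul_eq_zero_iff.mp ⟨v, hv, h0⟩)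
  have h5 : 0 < (v ᵥ* P) ⬝ᵥ star (v ᵥ* P) := Matrix.dotProduct_self_star_pos_iff.mpr h4
  have h6 : 0 < v ⬝ᵥ star v := Matrix.dotProduct_self_star_pos_iff.mpr hv
  rw [← h3, ← h, h2] at h5
  have h8 : z * star z = ((‖z‖ ^ 2 : ℝ) : ℂ) := by
    rw [← Complex.normSq_eq_norm_sq]; exact Complex.mul_conj z
  obtain ⟨hr, hi⟩ := Complex.pos_iff.mp h6
  have hrv : v ⬝ᵥ star v = ((v ⬝ᵥ star v).re : ℂ) := Complex.ext rfl hi.symm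
  rw [h8, hrv] at h5
  have h7 : 0 < (1 - ‖z‖ ^ 2) * (v ⬝ᵥ star v).re := by exact_mod_cast h5
  have h9 : ‖z‖ ^ 2 < 1 := sub_pos.mp (pos_of_mul_pos_left h7 hr.le)
  exact (sq_lt_one_iff₀ (norm_nonneg z)).mp h9

/-- `a a* = 1 + b b*` is positive definite. -/
theorem det_ne_zero_of_mul_conjTranspose {a b : Matrix n n ℂ} (h : a * aᴴ - b * bᴴ = 1) :
    a.det ≠ 0 := by
  have h1 : a * aᴴ = 1 + b * bᴴ := by rw [← h]; abel
  have h2 : (1 + b * bᴴ).PosDef :=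
    Matrix.PosDef.one.add_posSemidef (Matrix.posSemidef_self_mul_conjTranspose b)
  have h3 := h2.det_pos
  rw [← h1, Matrix.det_mul] at h3
  exact left_ne_zero_of_mul h3.ne'

end Disk

/-! ### The Cayley conjugate in `U(m, m)` and its blocks -/

variable {m : ℕ}

/-- The unnormalized Cayley element. -/
def cayL (m : ℕ) : Matrix (Fin m ⊕ Fin m) (Fin m ⊕ Fin m) ℂ :=
  Matrix.fromBlocks 1 (-(Complex.I • 1)) 1 (Complex.I • 1)

/-- The inverse of the unnormalized Cayley element. -/
def cayR (m : ℕ) : Matrix (Fin m ⊕ Fin m) (Fin m ⊕ Fin m) ℂ :=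
  (1 / 2 : ℂ) • Matrix.fromBlocks 1 1 (Complex.I • 1) (-(Complex.I • 1))

theorem cayL_mul_cayR : cayL m * cayR m = 1 := by
  rw [cayL, cayR, Matrix.mul_smul, Matrix.fromBlocks_multiply, Matrix.fromBlocks_smul,
    ← Matrix.fromBlocks_one]
  congr 1 <;> simp [smul_smul, ← two_smul ℂ (1 : Matrix (Fin m) (Fin m) ℂ)]

theorem cayR_mul_cayL : cayR m * cayL m = 1 :=
  mul_eq_one_comm.mp cayL_mul_cayR

/-- The signature matrix `diag(I, -I)`. -/
def sig (m : ℕ) : Matrix (Fin m ⊕ Fin m) (Fin m ⊕ Fin m) ℂ := Matrix.fromBlocks 1 0 0 (-1)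

theorem sig_mul_sig : sig m * sig m = 1 := by
  simp [sig, Matrix.fromBlocks_multiply, ← Matrix.fromBlocks_one]

theorem cayL_sig : (cayL m)ᴴ * sig m * cayL m = (2 * Complex.I) • Matrix.J (Fin m) ℂ := by
  rw [cayL, sig, Matrix.fromBlocks_conjTranspose, Matrix.fromBlocks_multiply,
    Matrix.fromBlocks_multiply, Matrix.J, Matrix.fromBlocks_smul]
  congr 1 <;> simp [smul_smul, two_mul, add_smul]

/-- The Cayley conjugate `𝒞 M 𝒞⁻¹`, an element of `U(m, m)`. -/
def cayN (g : HSp m) : Matrix (Fin m ⊕ Fin m) (Fin m ⊕ Fin m) ℂ :=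
  cayL m * hspMatrix g * cayR m

theorem cayley_conj (g : HSp m) : cayley m * hspMatrix g * (cayley m)⁻¹ = cayN g := by
  have h0 : ((2 * Complex.I) ^ (1 / 2 : ℂ)) ≠ 0 := by
    rw [Complex.cpow_ne_zero_iff_of_exponent_ne_zero] <;> simp
  have h1 : (cayley m)⁻¹ = ((2 * Complex.I) ^ (1 / 2 : ℂ)) • cayR m := by
    apply Matrix.inv_eq_right_inv
    change (((2 * Complex.I) ^ (1 / 2 : ℂ))⁻¹ • cayL m) * _ = 1
    rw [Matrix.smul_mul, Matrix.mul_smul, smul_smul, inv_mul_cancel₀ h0, one_smul, cayL_mul_cayR]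
  rw [h1, cayN]
  change (((2 * Complex.I) ^ (1 / 2 : ℂ))⁻¹ • cayL m) * _ * _ = _
  rw [Matrix.smul_mul, Matrix.smul_mul, Matrix.mul_smul, smul_smul, inv_mul_cancel₀ h0, one_smul]

theorem cayN_mul (g h : HSp m) : cayN (g * h) = cayN g * cayN h := by
  have : hspMatrix (g * h) = hspMatrix g * hspMatrix h := rfl
  calc cayN (g * h) = cayL m * (hspMatrix g * 1 * hspMatrix h) * cayR m := by
        rw [cayN, this, Matrix.mul_one]
    _ = _ := by rw [← cayR_mul_cayL]; simp only [cayN, Matrix.mul_assoc]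

theorem cayN_one : cayN (1 : HSp m) = 1 := by
  have : hspMatrix (1 : HSp m) = 1 := rfl
  rw [cayN, this, Matrix.mul_one, cayL_mul_cayR]

theorem continuous_hspMatrix : Continuous (hspMatrix : HSp m → _) :=
  Units.continuous_val.comp continuous_subtype_val

theorem continuous_cayN : Continuous (cayN : HSp m → _) := by
  unfold cayN
  have := continuous_hspMatrix (m := m)
  fun_prop

theorem cayN_conjTranspose_mul (g : HSp m) : (cayN g)ᴴ * sig m * cayN g = sig m := by
  have hg : (hspMatrix g)ᴴ * Matrix.J (Fin m) ℂ * hspMatrix g = Matrix.J (Fin m) ℂ := g.2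
  have h1 : (cayL m * cayR m)ᴴ = 1 := by rw [cayL_mul_cayR, Matrix.conjTranspose_one]
  rw [Matrix.conjTranspose_mul] at h1
  calc _ = (cayR m)ᴴ * ((hspMatrix g)ᴴ * ((cayL m)ᴴ * sig m * cayL m) * hspMatrix g) * cayR m := by
        simp only [cayN, Matrix.conjTranspose_mul, Matrix.mul_assoc]
    _ = (cayR m)ᴴ * ((cayL m)ᴴ * sig m * cayL m) * cayR m := by
        rw [cayL_sig, Matrix.mul_smul, Matrix.smul_mul, hg]
    _ = ((cayR m)ᴴ * (cayL m)ᴴ) * sig m * (cayL m * cayR m) := by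
        simp only [Matrix.mul_assoc]
    _ = _ := by rw [h1, cayL_mul_cayR, Matrix.one_mul, Matrix.mul_one]

theorem cayN_mul_conjTranspose (g : HSp m) : cayN g * sig m * (cayN g)ᴴ = sig m := by
  have h1 : (sig m * (cayN g)ᴴ * sig m) * cayN g = 1 := by
    rw [Matrix.mul_assoc, Matrix.mul_assoc, ← Matrix.mul_assoc (cayN g)ᴴ, cayN_conjTranspose_mul,
      sig_mul_sig]
  have h2 := mul_eq_one_comm.mp h1
  calc _ = cayN g * (sig m * (cayN g)ᴴ * sig m) * sig m := by
        simp only [Matrix.mul_assoc, sig_mul_sig, Matrix.mul_one]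
    _ = _ := by rw [h2, Matrix.one_mul]

/-- The blocks of the Cayley conjugate. -/
def blkA (g : HSp m) : Matrix (Fin m) (Fin m) ℂ := (cayN g).toBlocks₁₁
/-- The upper right block of the Cayley conjugate. -/
def blkB (g : HSp m) : Matrix (Fin m) (Fin m) ℂ := (cayN g).toBlocks₁₂
/-- The lower left block of the Cayley conjugate. -/
def blkC (g : HSp m) : Matrix (Fin m) (Fin m) ℂ := (cayN g).toBlocks₂₁
/-- The lower right block of the Cayley conjugate. -/
def blkD (g : HSp m) : Matrix (Fin m) (Fin m) ℂ := (cayN g).toBlocks₂₂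

theorem cayN_eq (g : HSp m) : cayN g = Matrix.fromBlocks (blkA g) (blkB g) (blkC g) (blkD g) :=
  (Matrix.fromBlocks_toBlocks _).symm

theorem continuous_blkA : Continuous (blkA : HSp m → _) :=
  continuous_matrix fun i j => continuous_cayN.matrix_elem (.inl i) (.inl j)
theorem continuous_blkB : Continuous (blkB : HSp m → _) :=
  continuous_matrix fun i j => continuous_cayN.matrix_elem (.inl i) (.inr j)
theorem continuous_blkC : Continuous (blkC : HSp m → _) :=
  continuous_matrix fun i j => continuous_cayN.matrix_elem (.inr i) (.inl j)
theorem continuous_blkD : Continuous (blkD : HSp m → _) :=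
  continuous_matrix fun i j => continuous_cayN.matrix_elem (.inr i) (.inr j)

theorem blk_conjTranspose_mul (g : HSp m) :
    (blkA g)ᴴ * blkA g - (blkC g)ᴴ * blkC g = 1 ∧ (blkA g)ᴴ * blkB g = (blkC g)ᴴ * blkD g ∧
    (blkB g)ᴴ * blkA g = (blkD g)ᴴ * blkC g ∧
    (blkD g)ᴴ * blkD g - (blkB g)ᴴ * blkB g = 1 := by
  have h := cayN_conjTranspose_mul g
  rw [cayN_eq, sig, Matrix.fromBlocks_conjTranspose, Matrix.fromBlocks_multiply,
    Matrix.fromBlocks_multiply] at h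
  obtain ⟨h1, h2, h3, h4⟩ := Matrix.fromBlocks_inj.mp h
  simp only [Matrix.mul_one, Matrix.mul_zero, add_zero, zero_add, Matrix.mul_neg,
    Matrix.neg_mul] at h1 h2 h3 h4
  simp only [← sub_eq_add_neg] at h1 h2 h3 h4
  refine ⟨h1, sub_eq_zero.mp h2, sub_eq_zero.mp h3, ?_⟩
  rw [← neg_sub, h4, neg_neg]

theorem blk_mul_conjTranspose (g : HSp m) :
    blkA g * (blkA g)ᴴ - blkB g * (blkB g)ᴴ = 1 ∧ blkD g * (blkD g)ᴴ - blkC g * (blkC g)ᴴ = 1 := by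
  have h := cayN_mul_conjTranspose g
  rw [cayN_eq, sig, Matrix.fromBlocks_conjTranspose, Matrix.fromBlocks_multiply,
    Matrix.fromBlocks_multiply] at h
  obtain ⟨h1, -, -, h4⟩ := Matrix.fromBlocks_inj.mp h
  simp only [Matrix.mul_one, Matrix.mul_zero, add_zero, zero_add, Matrix.mul_neg,
    Matrix.neg_mul] at h1 h4
  simp only [← sub_eq_add_neg] at h1 h4
  refine ⟨h1, ?_⟩
  rw [← neg_sub, h4, neg_neg]

theorem det_blkA_ne_zero (g : HSp m) : (blkA g).det ≠ 0 :=
  det_ne_zero_of_mul_conjTranspose (blk_mul_conjTranspose g).1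

theorem det_blkD_ne_zero (g : HSp m) : (blkD g).det ≠ 0 :=
  det_ne_zero_of_mul_conjTranspose (blk_mul_conjTranspose g).2

theorem inv_mul_of_det_ne_zero {a : Matrix (Fin m) (Fin m) ℂ} (ha : a.det ≠ 0) : a⁻¹ * a = 1 :=
  Matrix.nonsing_inv_mul _ ha.isUnit

theorem mul_inv_of_det_ne_zero {a : Matrix (Fin m) (Fin m) ℂ} (ha : a.det ≠ 0) : a * a⁻¹ = 1 :=
  Matrix.mul_nonsing_inv _ ha.isUnit

theorem det_inv_ne_zero {a : Matrix (Fin m) (Fin m) ℂ} (ha : a.det ≠ 0) : a⁻¹.det ≠ 0 :=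
  (Matrix.isUnit_nonsing_inv_det _ ha.isUnit).ne_zero

theorem continuous_matrix_inv {X : Type*} [TopologicalSpace X] {f : X → Matrix (Fin m) (Fin m) ℂ}
    (hf : Continuous f) (h0 : ∀ x, (f x).det ≠ 0) : Continuous fun x => (f x)⁻¹ := by
  simp only [Matrix.inv_def, Ring.inverse_eq_inv']
  exact (hf.matrix_det.inv₀ h0).smul hf.matrix_adjugate

/-! ### The Möbius action on `U(m)` -/

/-- The unitary group `U(m)`. -/
abbrev UG (m : ℕ) : Type := Matrix.unitaryGroup (Fin m) ℂ

theorem conjTranspose_mul_self (W : UG m) :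
    (W : Matrix (Fin m) (Fin m) ℂ)ᴴ * (W : Matrix (Fin m) (Fin m) ℂ) = 1 :=
  Matrix.mem_unitaryGroup_iff'.mp W.2

theorem mul_conjTranspose_self (W : UG m) :
    (W : Matrix (Fin m) (Fin m) ℂ) * (W : Matrix (Fin m) (Fin m) ℂ)ᴴ = 1 :=
  Matrix.mem_unitaryGroup_iff.mp W.2

theorem norm_det_unitary (W : UG m) : ‖(W : Matrix (Fin m) (Fin m) ℂ).det‖ = 1 := by
  have h := Matrix.det_of_mem_unitary W.2
  exact CStarRing.norm_of_mem_unitary h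

theorem det_unitary_ne_zero (W : UG m) : (W : Matrix (Fin m) (Fin m) ℂ).det ≠ 0 :=
  norm_ne_zero_iff.mp (by rw [norm_det_unitary]; exact one_ne_zero)

/-- The contraction `a⁻¹ b W`. -/
def contrTop (p : HSp m × UG m) : Matrix (Fin m) (Fin m) ℂ :=
  (blkA p.1)⁻¹ * blkB p.1 * (p.2 : Matrix (Fin m) (Fin m) ℂ)

/-- The contraction `W* d⁻¹ c`. -/
def contrBot (p : HSp m × UG m) : Matrix (Fin m) (Fin m) ℂ :=
  (p.2 : Matrix (Fin m) (Fin m) ℂ)ᴴ * ((blkD p.1)⁻¹ * blkC p.1)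

theorem continuous_contrTop : Continuous (contrTop : HSp m × UG m → _) := by
  unfold contrTop
  have h1 := continuous_matrix_inv (continuous_blkA (m := m)) det_blkA_ne_zero
  have h2 := continuous_blkB (m := m)
  have h3 : Continuous fun p : HSp m × UG m => (blkA p.1)⁻¹ := h1.comp continuous_fst
  fun_prop

theorem continuous_contrBot : Continuous (contrBot : HSp m × UG m → _) := by
  unfold contrBot
  have h1 := continuous_matrix_inv (continuous_blkD (m := m)) det_blkD_ne_zero
  have h2 := continuous_blkC (m := m)
  have h3 : Continuous fun p : HSp m × UG m => (blkD p.1)⁻¹ := h1.comp continuous_fst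
  fun_prop

/-- With `K = a⁻¹ b W` and `W W* = 1`, the relation `a a* - b b* = 1` turns `1 - K K*` into `a⁻¹
(a⁻¹)*`. -/
theorem roots_contrTop (p : HSp m × UG m) : ∀ z ∈ (contrTop p).charpoly.roots, ‖z‖ < 1 := by
  have ha := det_blkA_ne_zero p.1
  refine norm_lt_one_of_mem_roots_charpoly (P := (blkA p.1)⁻¹) (det_inv_ne_zero ha) ?_
  have h1 := inv_mul_of_det_ne_zero ha
  have h2 : (blkA p.1)ᴴ * ((blkA p.1)⁻¹)ᴴ = 1 := by
    rw [← Matrix.conjTranspose_mul, h1, Matrix.conjTranspose_one]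
  calc _ = (blkA p.1)⁻¹ * blkA p.1 * ((blkA p.1)ᴴ * ((blkA p.1)⁻¹)ᴴ) -
        (blkA p.1)⁻¹ * blkB p.1 * ((p.2 : Matrix (Fin m) (Fin m) ℂ) *
          (p.2 : Matrix (Fin m) (Fin m) ℂ)ᴴ) * ((blkB p.1)ᴴ * ((blkA p.1)⁻¹)ᴴ) := by
        rw [h1, h2, Matrix.one_mul]
        simp only [contrTop, Matrix.conjTranspose_mul, Matrix.mul_assoc]
    _ = (blkA p.1)⁻¹ * (blkA p.1 * (blkA p.1)ᴴ - blkB p.1 * (blkB p.1)ᴴ) * ((blkA p.1)⁻¹)ᴴ := by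
        rw [mul_conjTranspose_self]
        simp only [Matrix.mul_sub, Matrix.sub_mul, Matrix.mul_assoc, Matrix.one_mul]
    _ = _ := by rw [(blk_mul_conjTranspose p.1).1, Matrix.mul_one]

/-- With `K = W* d⁻¹ c`, the relation `d d* - c c* = 1` gives `1 - K K* = P P*` for `P = W* d⁻¹`. -/
theorem roots_contrBot (p : HSp m × UG m) : ∀ z ∈ (contrBot p).charpoly.roots, ‖z‖ < 1 := by
  have hd := det_blkD_ne_zero p.1
  refine norm_lt_one_of_mem_roots_charpoly
    (P := (p.2 : Matrix (Fin m) (Fin m) ℂ)ᴴ * (blkD p.1)⁻¹) ?_ ?_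
  · rw [Matrix.det_mul, Matrix.det_conjTranspose]
    exact mul_ne_zero (star_ne_zero.mpr (det_unitary_ne_zero _)) (det_inv_ne_zero hd)
  have h1 := inv_mul_of_det_ne_zero hd
  have h2 : (blkD p.1)ᴴ * ((blkD p.1)⁻¹)ᴴ = 1 := by
    rw [← Matrix.conjTranspose_mul, h1, Matrix.conjTranspose_one]
  calc _ = (p.2 : Matrix (Fin m) (Fin m) ℂ)ᴴ * ((blkD p.1)⁻¹ * blkD p.1 *
        ((blkD p.1)ᴴ * ((blkD p.1)⁻¹)ᴴ)) * (p.2 : Matrix (Fin m) (Fin m) ℂ) -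
        contrBot p * (contrBot p)ᴴ := by
        rw [h1, h2, Matrix.one_mul, Matrix.mul_one, conjTranspose_mul_self]
    _ = (p.2 : Matrix (Fin m) (Fin m) ℂ)ᴴ * (blkD p.1)⁻¹ *
        (blkD p.1 * (blkD p.1)ᴴ - blkC p.1 * (blkC p.1)ᴴ) *
        (((blkD p.1)⁻¹)ᴴ * (p.2 : Matrix (Fin m) (Fin m) ℂ)) := by
        simp only [contrBot, Matrix.conjTranspose_mul, Matrix.conjTranspose_conjTranspose,
          Matrix.mul_sub, Matrix.sub_mul, Matrix.mul_assoc]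
    _ = _ := by
        rw [(blk_mul_conjTranspose p.1).2, Matrix.mul_one, Matrix.conjTranspose_mul,
          Matrix.conjTranspose_conjTranspose]

/-- The denominator `a + b W` of the Möbius action. -/
def den (g : HSp m) (W : Matrix (Fin m) (Fin m) ℂ) : Matrix (Fin m) (Fin m) ℂ :=
  blkA g + blkB g * W

/-- The numerator `c + d W` of the Möbius action. -/
def num (g : HSp m) (W : Matrix (Fin m) (Fin m) ℂ) : Matrix (Fin m) (Fin m) ℂ :=
  blkC g + blkD g * W

theorem det_one_add_contrTop_ne_zero (p : HSp m × UG m) : (1 + contrTop p).det ≠ 0 := by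
  simpa using det_one_add_ne_zero (roots_contrTop p) 1

theorem det_one_add_contrBot_ne_zero (p : HSp m × UG m) : (1 + contrBot p).det ≠ 0 := by
  simpa using det_one_add_ne_zero (roots_contrBot p) 1

theorem det_den (g : HSp m) (W : UG m) :
    (den g W).det = (blkA g).det * (1 + contrTop (g, W)).det := by
  rw [← Matrix.det_mul, Matrix.mul_add, contrTop, ← Matrix.mul_assoc, ← Matrix.mul_assoc,
    mul_inv_of_det_ne_zero (det_blkA_ne_zero g), Matrix.mul_one, Matrix.one_mul, den]

/-- From `c + d W = d W (1 + W* d⁻¹ c)`. Extracting `d W` on the left isolates `det W` and leaves a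
contraction. -/
theorem det_num (g : HSp m) (W : UG m) :
    (num g W).det = (blkD g).det * (W : Matrix (Fin m) (Fin m) ℂ).det *
      (1 + contrBot (g, W)).det := by
  rw [← Matrix.det_mul, ← Matrix.det_mul, Matrix.mul_add, contrBot, Matrix.mul_one, num]
  congr 1
  calc _ = blkD g * (blkD g)⁻¹ * blkC g + blkD g * W := by
        rw [mul_inv_of_det_ne_zero (det_blkD_ne_zero g), Matrix.one_mul]
    _ = blkD g * ((W : Matrix (Fin m) (Fin m) ℂ) * (W : Matrix (Fin m) (Fin m) ℂ)ᴴ) *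
        ((blkD g)⁻¹ * blkC g) + blkD g * W := by
        rw [mul_conjTranspose_self]; simp only [Matrix.mul_assoc, Matrix.one_mul]
    _ = _ := by rw [add_comm]; simp only [Matrix.mul_assoc]

theorem det_den_ne_zero (g : HSp m) (W : UG m) : (den g W).det ≠ 0 := by
  rw [det_den]
  exact mul_ne_zero (det_blkA_ne_zero g) (det_one_add_contrTop_ne_zero _)

/-- The column `(1; W)` is isotropic for `diag(I, -I)` because `W` is unitary, and `U(m, m)`
preserves this form; hence `(den; num)` is isotropic too. This makes `act` unitary valued. -/
theorem num_conjTranspose_mul_num (g : HSp m) (W : UG m) :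
    (num g W)ᴴ * num g W = (den g W)ᴴ * den g W := by
  obtain ⟨h1, h2, h3, h4⟩ := blk_conjTranspose_mul g
  have e1 : (blkA g)ᴴ * blkA g = 1 + (blkC g)ᴴ * blkC g := by rw [← h1]; abel
  have e4 : (blkD g)ᴴ * blkD g = 1 + (blkB g)ᴴ * blkB g := by rw [← h4]; abel
  set w : Matrix (Fin m) (Fin m) ℂ := (W : Matrix (Fin m) (Fin m) ℂ) with hw
  have hW : wᴴ * w = 1 := conjTranspose_mul_self W
  calc _ = (blkC g)ᴴ * blkC g + ((blkC g)ᴴ * blkD g) * w + wᴴ * ((blkD g)ᴴ * blkC g) +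
        wᴴ * ((blkD g)ᴴ * blkD g) * w := by
        simp only [num, Matrix.conjTranspose_add, Matrix.conjTranspose_mul, Matrix.mul_add,
          Matrix.add_mul, Matrix.mul_assoc]
        abel
    _ = (blkA g)ᴴ * blkA g + ((blkA g)ᴴ * blkB g) * w + wᴴ * ((blkB g)ᴴ * blkA g) +
        wᴴ * ((blkB g)ᴴ * blkB g) * w := by
        rw [e1, e4, h2, h3, Matrix.mul_add, Matrix.add_mul, Matrix.mul_one, hW]
        abel
    _ = _ := by
        simp only [den, Matrix.conjTranspose_add, Matrix.conjTranspose_mul, Matrix.mul_add,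
          Matrix.add_mul, Matrix.mul_assoc]
        abel

/-- The action of `HSp(2m, ℂ)` on `U(m)`, `W ↦ (c + d W)(a + b W)⁻¹`. -/
def act (g : HSp m) (W : UG m) : UG m :=
  ⟨num g W * (den g W)⁻¹, by
    rw [Matrix.mem_unitaryGroup_iff', Matrix.star_eq_conjTranspose, Matrix.conjTranspose_mul]
    have h := mul_inv_of_det_ne_zero (det_den_ne_zero g W)
    calc _ = ((den g W)⁻¹)ᴴ * ((num g W)ᴴ * num g W) * (den g W)⁻¹ := by
          simp only [Matrix.mul_assoc]
      _ = (den g W * (den g W)⁻¹)ᴴ * (den g W * (den g W)⁻¹) := by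
          rw [num_conjTranspose_mul_num, Matrix.conjTranspose_mul]
          simp only [Matrix.mul_assoc]
      _ = 1 := by rw [h, Matrix.conjTranspose_one, Matrix.mul_one]⟩

theorem coe_act_mul_den (g : HSp m) (W : UG m) :
    (act g W : Matrix (Fin m) (Fin m) ℂ) * den g W = num g W := by
  change num g W * (den g W)⁻¹ * den g W = _
  rw [Matrix.mul_assoc, inv_mul_of_det_ne_zero (det_den_ne_zero g W), Matrix.mul_one]

theorem act_eq_of_mul_den {g : HSp m} {W V : UG m}
    (h : (V : Matrix (Fin m) (Fin m) ℂ) * den g W = num g W) : act g W = V := by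
  apply Subtype.ext
  change num g W * (den g W)⁻¹ = _
  rw [← h, Matrix.mul_assoc, mul_inv_of_det_ne_zero (det_den_ne_zero g W), Matrix.mul_one]

theorem continuous_act : Continuous fun p : HSp m × UG m => act p.1 p.2 := by
  refine Continuous.subtype_mk ?_ _
  have hA := continuous_blkA (m := m)
  have hB := continuous_blkB (m := m)
  have hC := continuous_blkC (m := m)
  have hD := continuous_blkD (m := m)
  have h1 : Continuous fun p : HSp m × UG m => den p.1 p.2 := by unfold den; fun_prop
  have h2 : Continuous fun p : HSp m × UG m => num p.1 p.2 := by unfold num; fun_prop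
  exact h2.mul (continuous_matrix_inv h1 fun p => det_den_ne_zero _ _)

theorem blk_mul (g h : HSp m) :
    blkA (g * h) = blkA g * blkA h + blkB g * blkC h ∧
    blkB (g * h) = blkA g * blkB h + blkB g * blkD h ∧
    blkC (g * h) = blkC g * blkA h + blkD g * blkC h ∧
    blkD (g * h) = blkC g * blkB h + blkD g * blkD h := by
  have h1 := cayN_mul g h
  rw [cayN_eq, cayN_eq, cayN_eq, Matrix.fromBlocks_multiply] at h1
  exact Matrix.fromBlocks_inj.mp h1

theorem act_mul (g h : HSp m) (W : UG m) : act (g * h) W = act g (act h W) := by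
  obtain ⟨hA, hB, hC, hD⟩ := blk_mul g h
  have h0 := coe_act_mul_den h W
  have h1 : den (g * h) W = den g (act h W) * den h W := by
    conv_rhs => rw [den, Matrix.add_mul, Matrix.mul_assoc, h0]
    simp only [den, num, hA, hB, Matrix.mul_add, Matrix.add_mul, Matrix.mul_assoc]
    abel
  have h2 : num (g * h) W = num g (act h W) * den h W := by
    conv_rhs => rw [num, Matrix.add_mul, Matrix.mul_assoc, h0]
    simp only [den, num, hC, hD, Matrix.mul_add, Matrix.add_mul, Matrix.mul_assoc]
    abel
  apply act_eq_of_mul_den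
  rw [h1, h2, ← Matrix.mul_assoc, coe_act_mul_den]

theorem act_one (W : UG m) : act 1 W = W := by
  have h := cayN_one (m := m)
  rw [cayN_eq, ← Matrix.fromBlocks_one] at h
  obtain ⟨hA, hB, hC, hD⟩ := Matrix.fromBlocks_inj.mp h
  apply act_eq_of_mul_den
  simp [den, num, hA, hB, hC, hD]

/-! ### The determinant cocycle -/

/-- The phase of `det d / det a`. -/
def kappa (g : HSp m) : Circle := phase ((blkD g).det / (blkA g).det)

theorem continuous_kappa : Continuous (kappa : HSp m → Circle) :=
  continuous_phase_comp (continuous_blkD.matrix_det.div continuous_blkA.matrix_det det_blkA_ne_zero)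
    fun g => div_ne_zero (det_blkD_ne_zero g) (det_blkA_ne_zero g)

/-- The determinant of a unitary matrix, as a point of the circle. -/
def detU (W : UG m) : Circle := phase (W : Matrix (Fin m) (Fin m) ℂ).det

theorem coe_detU (W : UG m) : (detU W : ℂ) = (W : Matrix (Fin m) (Fin m) ℂ).det := by
  rw [detU, coe_phase (det_unitary_ne_zero W), norm_det_unitary]
  simp

/-- The determinant cocycle of the action on `U(m)` has, up to the phase `kappa`, a bounded
continuous argument. -/
theorem exists_bounded_arg (m : ℕ) : ∃ (E : C(HSp m × UG m, ℝ)) (C : ℝ), (∀ p, |E p| ≤ C) ∧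
    ∀ g W, detU (act g W) = detU W * kappa g * expTwoPi (E (g, W)) := by
  obtain ⟨ε₁, hb₁, h₁⟩ := exists_arg_det_one_add (continuous_contrTop (m := m)) roots_contrTop
  obtain ⟨ε₂, hb₂, h₂⟩ := exists_arg_det_one_add (continuous_contrBot (m := m)) roots_contrBot
  -- The numerator contributes `ε₂` and the denominator `ε₁`, each bounded by the matrix size `m`.
  refine ⟨ε₂ - ε₁, m + m, fun p => ?_, fun g W => ?_⟩
  · have := hb₁ p
    have := hb₂ p
    rw [Fintype.card_fin] at *
    rw [ContinuousMap.sub_apply]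
    exact (abs_sub _ _).trans (by linarith)
  · have hn := det_num g W
    have hd := det_den g W
    have ha := det_blkA_ne_zero g
    have hd' := det_blkD_ne_zero g
    have hW := det_unitary_ne_zero W
    have hT := det_one_add_contrTop_ne_zero (g, W)
    have hB := det_one_add_contrBot_ne_zero (g, W)
    have hact := congrArg Matrix.det (coe_act_mul_den g W)
    rw [Matrix.det_mul, hd, hn] at hact
    have hact' := congrArg phase hact
    rw [phase_mul (det_unitary_ne_zero _) (mul_ne_zero ha hT), phase_mul ha hT, h₁,
      phase_mul (mul_ne_zero hd' hW) hB, phase_mul hd' hW, h₂] at hact'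
    rw [ContinuousMap.sub_apply, expTwoPi_sub, kappa, phase_div hd' ha]
    change detU (act g W) * _ = _ * detU W * _ at hact'
    rw [eq_comm, mul_div_assoc', div_eq_iff_eq_mul, mul_div_assoc', div_mul_eq_mul_div,
      div_eq_iff_eq_mul]
    rw [mul_comm (phase _) (detU W)] at hact'
    rw [← hact']
    simp only [mul_comm, mul_left_comm]

/-! ### Connectedness of `U(m)` and `SU(m)` -/

section Connected

open scoped Matrix.Norms.L2Operator

/-- Unitaries at distance less than `2` are joined by a path. The spectrum of `U` is finite, so some
scalar `e^{2πix}` has its antipode outside it; `U` is then at distance less than `2` from that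
scalar matrix, which is joined to `1` through scalars. -/
theorem joined_one_unitary (U : UG m) : Joined (1 : UG m) U := by
  let A := Matrix (Fin m) (Fin m) ℂ
  have hfin : (spectrum ℂ (U : A)).Finite := Matrix.finite_spectrum _
  obtain ⟨x, hx⟩ : ∃ x : ℝ, (-(expTwoPi x : ℂ)) ∉ spectrum ℂ (U : A) := by
    by_contra! h
    refine Set.Ioo_infinite (zero_lt_one (α := ℝ)) (Set.Finite.of_injOn (fun x _ => h x) ?_ hfin)
    intro x hx y hy hxy
    obtain ⟨k, hk⟩ := (expTwoPi_eq_iff x y).mp (Circle.ext (neg_injective hxy))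
    have h1 : (-1 : ℝ) < k := by linarith [hx.1, hy.2]
    have h2 : (k : ℝ) < 1 := by linarith [hx.2, hy.1]
    have h3 : k = 0 := by
      have h4 : -1 < k := by exact_mod_cast h1
      have h5 : k < 1 := by exact_mod_cast h2
      omega
    simpa [h3] using hk
  let s : Circle → UG m := fun z => ⟨(z : ℂ) • (1 : A), by
    rw [Matrix.mem_unitaryGroup_iff, star_smul, star_one, smul_mul_smul_comm, Matrix.one_mul]
    have : (z : ℂ) * star (z : ℂ) = 1 := by
      have := Complex.mul_conj (z : ℂ)
      rw [Circle.normSq_coe] at this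
      simpa using this
    rw [this, one_smul]⟩
  have hs : Continuous s := Continuous.subtype_mk (by fun_prop) _
  have hj : Joined (1 : UG m) (s (expTwoPi x)) :=
    ⟨{ toFun := fun t => s (expTwoPi (t * x))
       continuous_toFun := hs.comp (continuous_expTwoPi.comp (by fun_prop))
       source' := by
         apply Subtype.ext
         simp [s, expTwoPi_zero]
       target' := by simp }⟩
  refine hj.trans (Unitary.joined (A := A) _ _ ?_)
  rw [Unitary.norm_sub_eq]
  refine (Unitary.norm_sub_one_lt_two_iff (SetLike.coe_mem _)).mpr ?_
  have hu : ((expTwoPi x : Circle) : ℂ) * star ((expTwoPi x : Circle) : ℂ) = 1 := by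
    have h := Complex.mul_conj (expTwoPi x : ℂ)
    rw [Circle.normSq_coe] at h
    simpa using h
  have h1 : ((U * star (s (expTwoPi x)) : UG m) : A) = star (expTwoPi x : ℂ) • (U : A) := by
    change (U : A) * star ((expTwoPi x : ℂ) • (1 : A)) = _
    rw [star_smul, star_one, Matrix.mul_smul, Matrix.mul_one]
  let r : ℂˣ := ⟨star (expTwoPi x : ℂ), (expTwoPi x : ℂ), by rw [mul_comm, hu], hu⟩
  intro h
  apply hx
  rw [← spectrum.smul_mem_smul_iff (r := r)]
  have h2 : r • (-(expTwoPi x : ℂ)) = -1 := by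
    change star (expTwoPi x : ℂ) * -(expTwoPi x : ℂ) = -1
    rw [mul_neg, mul_comm, hu]
  rw [h2]
  exact h1 ▸ h

instance : PathConnectedSpace (UG m) where
  nonempty := ⟨1⟩
  joined U V := (joined_one_unitary U).symm.trans (joined_one_unitary V)

end Connected

/-- The special unitary group `SU(m)`. -/
abbrev SU (m : ℕ) : Type := Matrix.specialUnitaryGroup (Fin m) ℂ

/-- `SU(m)` is a continuous image of `U(m)`: correct the determinant by multiplying with `diag(conj
(det U), 1, …, 1)`, which changes nothing on `SU(m)`. -/
theorem connectedSpace_specialUnitary (hm : 0 < m) : ConnectedSpace (SU m) := by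
  let δ : UG m → Fin m → ℂ := fun U i =>
    if i = ⟨0, hm⟩ then star (U : Matrix (Fin m) (Fin m) ℂ).det else 1
  have hδ : ∀ U, (Matrix.diagonal (δ U)).det = star (U : Matrix (Fin m) (Fin m) ℂ).det := by
    intro U
    rw [Matrix.det_diagonal, Finset.prod_ite_eq']
    simp
  have hu : ∀ U : UG m,
      (U : Matrix (Fin m) (Fin m) ℂ).det * star (U : Matrix (Fin m) (Fin m) ℂ).det = 1 :=
    fun U => (Unitary.mem_iff.mp (Matrix.det_of_mem_unitary U.2)).2
  let ret : UG m → SU m := fun U => ⟨(U : Matrix (Fin m) (Fin m) ℂ) * Matrix.diagonal (δ U), by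
    rw [Matrix.mem_specialUnitaryGroup_iff]
    constructor
    · refine mul_mem U.2 ?_
      rw [Matrix.mem_unitaryGroup_iff, Matrix.star_eq_conjTranspose, Matrix.diagonal_conjTranspose,
        Matrix.diagonal_mul_diagonal, ← Matrix.diagonal_one]
      congr 1
      funext i
      simp only [δ, Pi.star_apply]
      split_ifs
      · rw [star_star, mul_comm, hu]
      · simp
    · rw [Matrix.det_mul, hδ, hu]⟩
  have hret : Continuous ret := by
    refine Continuous.subtype_mk (continuous_subtype_val.mul (Continuous.matrix_diagonal ?_)) _
    refine continuous_pi fun i => ?_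
    simp only [δ]
    split_ifs
    · exact continuous_star.comp continuous_subtype_val.matrix_det
    · exact continuous_const
  have hsurj : Function.Surjective ret := fun S => by
    refine ⟨⟨S, Matrix.specialUnitaryGroup_le_unitaryGroup S.2⟩, Subtype.ext ?_⟩
    have hd : (S : Matrix (Fin m) (Fin m) ℂ).det = 1 :=
      (Matrix.mem_specialUnitaryGroup_iff.mp S.2).2
    simp [ret, δ, hd]
  exact hsurj.connectedSpace hret

/-! ### The covering of `U(m)`, Lagrangian frames and polar decompositions -/

/-- The covering `(x, S) ↦ e^{2πix} S` with values in `U(m)`. -/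
def coverU (x : ℝ) (S : SU m) : UG m := ⟨unitaryCover x S, by
  rw [Matrix.mem_unitaryGroup_iff, unitaryCover, ← coe_expTwoPi, star_smul, smul_mul_smul_comm,
    Matrix.mem_unitaryGroup_iff.mp (Matrix.specialUnitaryGroup_le_unitaryGroup S.2)]
  have h := Complex.mul_conj (expTwoPi x : ℂ)
  rw [Circle.normSq_coe] at h
  change (_ * (starRingEnd ℂ) _ : ℂ) • _ = _
  rw [h]; simp⟩

theorem continuous_coverU : Continuous fun p : ℝ × SU m => coverU p.1 p.2 := by
  refine Continuous.subtype_mk ?_ _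
  unfold unitaryCover
  fun_prop

theorem detU_coverU (x : ℝ) (S : SU m) : detU (coverU x S) = expTwoPi (m * x) := by
  apply Circle.ext
  rw [coe_detU, expTwoPi_natCast_mul, Circle.coe_pow, coe_expTwoPi]
  change (unitaryCover x S).det = _
  rw [unitaryCover, Matrix.det_smul, (Matrix.mem_specialUnitaryGroup_iff.mp S.2).2, mul_one,
    Fintype.card_fin]

/-- The explicit formula for `S` is recorded because the continuity of the lift in
`IsAngle.exists_isLift` is read off from it. -/
theorem exists_coverU_eq {x : ℝ} {W : UG m} (h : detU W = expTwoPi (m * x)) :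
    ∃ S : SU m, (S : Matrix (Fin m) (Fin m) ℂ) =
      ((expTwoPi (-x) : Circle) : ℂ) • (W : Matrix (Fin m) (Fin m) ℂ) ∧ coverU x S = W := by
  have h1 : ((expTwoPi (-x) : Circle) : ℂ) * star ((expTwoPi (-x) : Circle) : ℂ) = 1 := by
    have h := Complex.mul_conj (expTwoPi (-x) : ℂ)
    rw [Circle.normSq_coe] at h
    simpa using h
  refine ⟨⟨((expTwoPi (-x) : Circle) : ℂ) • (W : Matrix (Fin m) (Fin m) ℂ), ?_⟩, rfl, ?_⟩
  · rw [Matrix.mem_specialUnitaryGroup_iff]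
    constructor
    · rw [Matrix.mem_unitaryGroup_iff, star_smul, smul_mul_smul_comm, h1, one_smul]
      exact Matrix.mem_unitaryGroup_iff.mp W.2
    · rw [Matrix.det_smul, Fintype.card_fin, ← coe_detU, h, ← Circle.coe_pow, ← Circle.coe_mul,
        ← expTwoPi_natCast_mul, ← expTwoPi_add]
      simp [expTwoPi_zero]
  · apply Subtype.ext
    change unitaryCover x _ = _
    rw [unitaryCover, ← coe_expTwoPi]
    change (_ : ℂ) • ((_ : ℂ) • (W : Matrix (Fin m) (Fin m) ℂ)) = _
    rw [smul_smul, ← Circle.coe_mul, ← expTwoPi_add]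
    simp [expTwoPi_zero]

theorem toRows_cayL_mul (L : Matrix (Fin m ⊕ Fin m) (Fin m) ℂ) :
    cayL m * L = Matrix.fromRows (L.toRows₁ - Complex.I • L.toRows₂)
      (L.toRows₁ + Complex.I • L.toRows₂) := by
  conv_lhs => rw [← Matrix.fromRows_toRows L, cayL]
  rw [Matrix.fromBlocks_mul_fromRows]
  simp [sub_eq_add_neg]

/-- The Lagrangian condition cancels the cross terms in `(X - iY)* (X - iY)`, leaving `X* X + Y* Y =
L* L`. A kernel vector of `X - iY` is thus a kernel vector of `L`, which has full column rank. -/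
theorem IsLagrangianFrame.det_ne_zero {L : Matrix (Fin m ⊕ Fin m) (Fin m) ℂ}
    (hL : IsLagrangianFrame L) : (L.toRows₁ - Complex.I • L.toRows₂).det ≠ 0 := by
  obtain ⟨h1, h2⟩ := hL
  intro h0
  obtain ⟨v, hv, hv0⟩ := Matrix.exists_mulVec_eq_zero_iff.mpr h0
  have h3 : (L.toRows₁ - Complex.I • L.toRows₂)ᴴ * (L.toRows₁ - Complex.I • L.toRows₂) =
      Lᴴ * L := by
    have : Lᴴ * L = L.toRows₁ᴴ * L.toRows₁ + L.toRows₂ᴴ * L.toRows₂ := by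
      conv_lhs => rw [← Matrix.fromRows_toRows L]
      rw [Matrix.conjTranspose_fromRows_eq_fromCols_conjTranspose, Matrix.fromCols_mul_fromRows]
    rw [this, Matrix.conjTranspose_sub, Matrix.conjTranspose_smul, Matrix.sub_mul, Matrix.mul_sub,
      Matrix.mul_sub]
    simp only [Matrix.mul_smul, Matrix.smul_mul, h1, smul_smul]
    simp
    abel
  have h4 : (Lᴴ * L) *ᵥ v = 0 := by
    rw [← h3, ← Matrix.mulVec_mulVec, hv0, Matrix.mulVec_zero]
  have h5 : L *ᵥ v = 0 := (Matrix.conjTranspose_mul_self_mulVec_eq_zero L v).mp h4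
  have h6 := L.mulVecLin.finrank_range_add_finrank_ker
  have h7 : Module.finrank ℂ (LinearMap.range L.mulVecLin) = m := h2
  rw [h7, Module.finrank_fintype_fun_eq_card, Fintype.card_fin] at h6
  have h8 : LinearMap.ker L.mulVecLin = ⊥ := Submodule.finrank_eq_zero.mp (by omega)
  exact hv ((LinearMap.ker_eq_bot'.mp h8) v h5)

/-- The Cayley element sends `L` to `(X - iY; X + iY) = (1; W)(X - iY)`, so multiplication by `g`
becomes the Möbius action, and the invertible factor `X - iY` cancels. -/
theorem lagW_mul {L : Matrix (Fin m ⊕ Fin m) (Fin m) ℂ} (hL : IsLagrangianFrame L) {W : UG m}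
    (hW : (W : Matrix (Fin m) (Fin m) ℂ) = lagW L) (g : HSp m) :
    lagW (hspMatrix g * L) = act g W := by
  have ht := hL.det_ne_zero
  set t := L.toRows₁ - Complex.I • L.toRows₂ with htd
  have hs : L.toRows₁ + Complex.I • L.toRows₂ = (W : Matrix (Fin m) (Fin m) ℂ) * t := by
    rw [hW, lagW, Matrix.mul_assoc, inv_mul_of_det_ne_zero ht, Matrix.mul_one]
  have h1 : cayL m * (hspMatrix g * L) = Matrix.fromRows (den g W * t) (num g W * t) := by
    calc _ = cayN g * (cayL m * L) := by
          simp only [cayN, Matrix.mul_assoc]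
          rw [← Matrix.mul_assoc (cayR m), cayR_mul_cayL, Matrix.one_mul]
      _ = _ := by
          rw [toRows_cayL_mul, hs, cayN_eq, Matrix.fromBlocks_mul_fromRows, den, num]
          simp only [Matrix.add_mul, Matrix.mul_assoc, ← htd]
  rw [toRows_cayL_mul] at h1
  obtain ⟨h2, h3⟩ := Matrix.fromRows_inj.eq_iff.mp h1
  rw [lagW, h2, h3, Matrix.mul_inv_rev, Matrix.mul_assoc, ← Matrix.mul_assoc t,
    mul_inv_of_det_ne_zero ht, Matrix.one_mul]
  rfl

/-- Every point of `U(m)` comes from a Lagrangian subspace, so the condition `IsLift.covers`, stated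
on frames, determines a lift over all of `U(m)`. -/
theorem exists_frame (W : UG m) : ∃ L : Matrix (Fin m ⊕ Fin m) (Fin m) ℂ,
    IsLagrangianFrame L ∧ (W : Matrix (Fin m) (Fin m) ℂ) = lagW L := by
  set w := (W : Matrix (Fin m) (Fin m) ℂ) with hw
  have hW : wᴴ * w = 1 := conjTranspose_mul_self W
  -- Solution of `X - iY = 1` and `X + iY = W`.
  let L := Matrix.fromRows ((1 / 2 : ℂ) • (w + 1)) ((-(Complex.I / 2)) • (w - 1))
  have h1 : L.toRows₁ - Complex.I • L.toRows₂ = 1 := by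
    simp only [L, Matrix.toRows₁_fromRows, Matrix.toRows₂_fromRows]
    ext i j
    simp only [Matrix.sub_apply, Matrix.smul_apply, Matrix.add_apply, smul_eq_mul]
    linear_combination (w i j - (1 : Matrix (Fin m) (Fin m) ℂ) i j) / 2 * Complex.I_sq
  have h2 : L.toRows₁ + Complex.I • L.toRows₂ = w := by
    simp only [L, Matrix.toRows₁_fromRows, Matrix.toRows₂_fromRows]
    ext i j
    simp only [Matrix.sub_apply, Matrix.smul_apply, Matrix.add_apply, smul_eq_mul]
    linear_combination (-(w i j - (1 : Matrix (Fin m) (Fin m) ℂ) i j) / 2) * Complex.I_sq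
  refine ⟨L, ⟨?_, ?_⟩, ?_⟩
  · simp only [L, Matrix.toRows₁_fromRows, Matrix.toRows₂_fromRows, Matrix.conjTranspose_smul,
      Matrix.conjTranspose_add, Matrix.conjTranspose_sub, Matrix.conjTranspose_one,
      Matrix.smul_mul, Matrix.mul_smul, Matrix.add_mul, Matrix.mul_add, Matrix.sub_mul,
      Matrix.mul_sub, hW, Matrix.one_mul, Matrix.mul_one]
    ext i j
    simp
    ring
  · apply le_antisymm
    · simpa using L.rank_le_card_width
    · let Q : Matrix (Fin m) (Fin m ⊕ Fin m) ℂ := Matrix.fromCols 1 (-(Complex.I • 1))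
      have h3 : Q * L = 1 := by
        refine Eq.trans ?_ h1
        conv_lhs => rw [← Matrix.fromRows_toRows L, Matrix.fromCols_mul_fromRows]
        simp [sub_eq_add_neg]
      have h4 := Matrix.rank_mul_le_right Q L
      rw [h3, Matrix.rank_one, Fintype.card_fin] at h4
      exact h4
  · rw [lagW, h1, h2]
    simp

/-- The diagonal blocks are `a = P₁₁ U₁` and `d = P₂₂ U₂`. Principal blocks of a positive definite
matrix have positive determinant, so they do not affect the phase. -/
theorem IsPolar.kappa_eq {g : HSp m} {P : Matrix (Fin m ⊕ Fin m) (Fin m ⊕ Fin m) ℂ} {U₁ U₂ : UG m}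
    (h : IsPolar g P U₁ U₂) {z : Circle}
    (hz : (z : ℂ) = ((U₁⁻¹ * U₂ : UG m) : Matrix (Fin m) (Fin m) ℂ).det) : z = kappa g := by
  obtain ⟨hP, -, h3⟩ := h
  rw [cayley_conj, cayN_eq, ← Matrix.fromBlocks_toBlocks P, Matrix.fromBlocks_multiply] at h3
  obtain ⟨hA, -, -, hD⟩ := Matrix.fromBlocks_inj.mp h3
  simp only [Matrix.mul_zero, add_zero, zero_add] at hA hD
  have hP1 : 0 < P.toBlocks₁₁.det := (hP.submatrix Sum.inl_injective).det_pos
  have hP2 : 0 < P.toBlocks₂₂.det := (hP.submatrix Sum.inr_injective).det_pos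
  have hz' : z = detU U₂ / detU U₁ := by
    apply Circle.ext
    rw [hz, Circle.coe_div, coe_detU, coe_detU, eq_div_iff (det_unitary_ne_zero U₁), mul_comm,
      ← Matrix.det_mul]
    change ((U₁ * (U₁⁻¹ * U₂) : UG m) : Matrix (Fin m) (Fin m) ℂ).det = _
    rw [mul_inv_cancel_left]
  rw [kappa, hA, hD, Matrix.det_mul, Matrix.det_mul,
    phase_div (mul_ne_zero hP2.ne' (det_unitary_ne_zero _))
      (mul_ne_zero hP1.ne' (det_unitary_ne_zero _)),
    phase_mul hP2.ne' (det_unitary_ne_zero _), phase_mul hP1.ne' (det_unitary_ne_zero _),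
    phase_of_pos hP1, phase_of_pos hP2, one_mul, one_mul, hz']
  rfl

/-! ### Convergence of Birkhoff averages from a factor, up to bounded error -/

section Averages

/-- For `s` the sequence of partial Birkhoff sums, the left side adds up the blocks of length `N`
starting at times below `n`, and the right side is nearly `N` copies of the sum of length `n`. -/
theorem sum_range_shift_sub (s : ℕ → ℝ) (N n : ℕ) :
    ∑ k ∈ Finset.range n, (s (k + N) - s k) = ∑ j ∈ Finset.range N, (s (n + j) - s j) := by
  induction n with
  | zero => simp
  | succ n ih =>
    have h : ∑ j ∈ Finset.range N, (s (n + 1 + j) - s (n + j)) = s (n + N) - s n := by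
      have := Finset.sum_range_sub (fun j => s (n + j)) N
      simpa [add_assoc, add_comm 1] using this
    rw [Finset.sum_range_succ, ih, ← h, ← Finset.sum_add_distrib]
    exact Finset.sum_congr rfl fun j _ => by ring

theorem abs_birkhoffSum_le {Y : Type*} {T : Y → Y} {f : Y → ℝ} {M : ℝ} (hf : ∀ y, |f y| ≤ M)
    (n : ℕ) (y : Y) : |birkhoffSum T f n y| ≤ n * M := by
  refine (Finset.abs_sum_le_sum_abs _ _).trans ?_
  refine (Finset.sum_le_sum fun k _ => hf _).trans ?_
  simp

/-- If the Birkhoff sums of a bounded function are, up to a bounded error, functions of a factor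
whose Birkhoff averages converge to constants, then the Birkhoff averages converge to a constant. -/
theorem exists_tendsto_birkhoffAverage {Y Θ : Type*} {T : Y → Y} {R : Θ → Θ} {p : Y → Θ}
    (hp : Function.Semiconj p T R) {f : Y → ℝ} {M : ℝ} (hf : ∀ y, |f y| ≤ M) {g : ℕ → Θ → ℝ}
    {I : ℕ → ℝ}
    (hI : ∀ N θ, Tendsto (fun n => birkhoffAverage ℝ R (g N) n θ) atTop (𝓝 (I N))) {C : ℝ}
    (hg : ∀ N y, |birkhoffSum T f N y - g N (p y)| ≤ C) :
    ∃ t : ℝ, ∀ y, Tendsto (fun n => birkhoffAverage ℝ T f n y) atTop (𝓝 t) := by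
  rcases isEmpty_or_nonempty Y with hY | ⟨⟨y₀⟩⟩
  · exact ⟨0, fun y => (hY.false y).elim⟩
  have hM : 0 ≤ M := (abs_nonneg _).trans (hf y₀)
  have hC : 0 ≤ C := (abs_nonneg _).trans (hg 0 y₀)
  -- Each of the `n` blocks of length `N` is within `C` of `g N`, which gives `n C`. Replacing their
  -- total by `N` times the long sum costs, for each of `N` shifts, two end pieces of at most `N`
  -- terms of size `M`.
  have key : ∀ N n : ℕ, ∀ y, |N * birkhoffSum T f n y - birkhoffSum R (g N) n (p y)| ≤
      n * C + N * (2 * N * M) := by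
    intro N n y
    have h1 := sum_range_shift_sub (fun k => birkhoffSum T f k y) N n
    have h2 : |∑ k ∈ Finset.range n, (birkhoffSum T f (k + N) y - birkhoffSum T f k y) -
        birkhoffSum R (g N) n (p y)| ≤ n * C := by
      rw [birkhoffSum, ← Finset.sum_sub_distrib]
      refine (Finset.abs_sum_le_sum_abs _ _).trans
        ((Finset.sum_le_sum fun k _ => ?_).trans (by simp : ∑ _k ∈ Finset.range n, C ≤ n * C))
      rw [birkhoffSum_add, add_sub_cancel_left, ← (hp.iterate_right k).eq]
      exact hg _ _
    have h3 : |∑ j ∈ Finset.range N, (birkhoffSum T f (n + j) y - birkhoffSum T f j y) -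
        N * birkhoffSum T f n y| ≤ N * (2 * N * M) := by
      have : (N : ℝ) * birkhoffSum T f n y = ∑ _j ∈ Finset.range N, birkhoffSum T f n y := by simp
      rw [this, ← Finset.sum_sub_distrib]
      refine (Finset.abs_sum_le_sum_abs _ _).trans
        ((Finset.sum_le_sum fun j hj => ?_).trans
          (by simp : ∑ _j ∈ Finset.range N, 2 * (N : ℝ) * M ≤ N * (2 * N * M)))
      have hj' : (j : ℝ) * M ≤ N * M := by
        gcongr
        exact (Finset.mem_range.mp hj).le
      rw [birkhoffSum_add, show ∀ a b c : ℝ, a + b - c - a = b - c by intros; ring]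
      have h4 := abs_birkhoffSum_le (T := T) hf j (T^[n] y)
      have h5 := abs_birkhoffSum_le (T := T) hf j y
      exact (abs_sub _ _).trans (by linarith)
    rw [h1] at h2
    have h6 := abs_sub_le_iff.mp h2
    have h7 := abs_sub_le_iff.mp h3
    exact abs_sub_le_iff.mpr ⟨by linarith [h6.1, h7.2], by linarith [h6.2, h7.1]⟩
  -- Division by `n N` makes the end effects vanish as `n → ∞`; only the block error `C / N`
  -- remains.
  have close : ∀ N : ℕ, 0 < N → ∀ y, ∀ ε > 0, ∀ᶠ n : ℕ in atTop,
      |birkhoffAverage ℝ T f n y - I N / N| ≤ C / N + ε := by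
    intro N hN y ε hε
    have hN' : (0 : ℝ) < N := by exact_mod_cast hN
    have e1 := Metric.tendsto_atTop.mp (hI N (p y)) (N * (ε / 2)) (by positivity)
    have e2 : Tendsto (fun n : ℕ => 2 * N * M / (n : ℝ)) atTop (𝓝 0) :=
      tendsto_const_div_atTop_nhds_zero_nat _
    obtain ⟨n₁, h₁⟩ := e1
    filter_upwards [eventually_ge_atTop n₁, eventually_gt_atTop 0,
      e2.eventually_lt_const (half_pos hε)] with n hn1 hn0 hn2
    have hn : (0 : ℝ) < n := by exact_mod_cast hn0
    have k1 := h₁ n hn1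
    have k2 := key N n y
    rw [Real.dist_eq] at k1
    rw [birkhoffAverage, smul_eq_mul] at k1
    have k3 : |birkhoffAverage ℝ T f n y - (n : ℝ)⁻¹ * birkhoffSum R (g N) n (p y) / N| ≤
        C / N + 2 * N * M / n := by
      have : birkhoffAverage ℝ T f n y - (n : ℝ)⁻¹ * birkhoffSum R (g N) n (p y) / N =
          (N * birkhoffSum T f n y - birkhoffSum R (g N) n (p y)) / (n * N) := by
        rw [birkhoffAverage, smul_eq_mul]
        field_simp
      rw [this, abs_div, abs_of_pos (mul_pos hn hN'), div_le_iff₀ (mul_pos hn hN')]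
      refine k2.trans (le_of_eq ?_)
      field_simp
    have k4 : |(n : ℝ)⁻¹ * birkhoffSum R (g N) n (p y) / N - I N / N| ≤ ε / 2 := by
      rw [← sub_div, abs_div, abs_of_pos hN', div_le_iff₀ hN', mul_comm (ε / 2)]
      exact k1.le
    have := abs_sub_le (birkhoffAverage ℝ T f n y)
      ((n : ℝ)⁻¹ * birkhoffSum R (g N) n (p y) / N) (I N / N)
    linarith
  -- The averages at the single point `y₀` approximate both quotients, so `I N / N` is Cauchy.
  have hdist : ∀ N M : ℕ, 0 < N → 0 < M → |I N / N - I M / M| ≤ C / N + C / M := by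
    intro N M hN hM
    refine le_of_forall_pos_le_add fun ε hε => ?_
    obtain ⟨n, h1, h2⟩ := ((close N hN y₀ (ε / 2) (half_pos hε)).and
      (close M hM y₀ (ε / 2) (half_pos hε))).exists
    have := abs_sub_le (I N / N) (birkhoffAverage ℝ T f n y₀) (I M / M)
    rw [abs_sub_comm (I N / N) (birkhoffAverage ℝ T f n y₀)] at this
    linarith
  have hC0 : Tendsto (fun n : ℕ => C / (n : ℝ)) atTop (𝓝 0) :=
    tendsto_const_div_atTop_nhds_zero_nat _
  have hcauchy : CauchySeq fun N : ℕ => I N / N := by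
    rw [Metric.cauchySeq_iff']
    intro ε hε
    obtain ⟨N, hN⟩ := ((hC0.eventually_lt_const (half_pos hε)).and
      (eventually_gt_atTop 0)).exists_forall_of_atTop
    refine ⟨N, fun n hn => ?_⟩
    rw [Real.dist_eq]
    have := hdist n N (hN n hn).2 (hN N le_rfl).2
    linarith [(hN n hn).1, (hN N le_rfl).1]
  obtain ⟨t, ht⟩ := cauchySeq_tendsto_of_complete hcauchy
  have hlim : ∀ N : ℕ, 0 < N → |I N / N - t| ≤ C / N := by
    intro N hN
    have h1 : Tendsto (fun M : ℕ => |I N / N - I M / M|) atTop (𝓝 |I N / N - t|) :=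
      (tendsto_const_nhds.sub ht).abs
    have h2 : Tendsto (fun M : ℕ => C / N + C / (M : ℝ)) atTop (𝓝 (C / N + 0)) :=
      tendsto_const_nhds.add hC0
    rw [add_zero] at h2
    exact le_of_tendsto_of_tendsto h1 h2
      ((eventually_gt_atTop 0).mono fun M hM => hdist N M hN hM)
  refine ⟨t, fun y => Metric.tendsto_atTop.mpr fun ε hε => ?_⟩
  obtain ⟨N, hN1, hN0⟩ := ((hC0.eventually_lt_const (show 0 < ε / 4 by positivity)).and
    (eventually_gt_atTop 0)).exists
  obtain ⟨n₀, hn₀⟩ := (close N hN0 y (ε / 4) (by positivity)).exists_forall_of_atTop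
  refine ⟨n₀, fun n hn => ?_⟩
  have h1 := hn₀ n hn
  have h2 := hlim N hN0
  rw [Real.dist_eq]
  have := abs_sub_le (birkhoffAverage ℝ T f n y) (I N / N) t
  linarith

end Averages

/-! ### Equidistribution of ergodic rotations of the torus -/

section Rotation

variable {d : ℕ}

instance : IsProbabilityMeasure (volume : Measure UnitAddCircle) :=
  ⟨by rw [AddCircle.measure_univ, ENNReal.ofReal_one]⟩

instance : IsProbabilityMeasure (volume : Measure (UnitAddTorus (Fin d))) :=
  inferInstanceAs (IsProbabilityMeasure
    (Measure.pi fun _ : Fin d => (volume : Measure UnitAddCircle)))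

theorem norm_mFourier_apply (n : Fin d → ℤ) (x : UnitAddTorus (Fin d)) :
    ‖UnitAddTorus.mFourier n x‖ = 1 := by
  simp only [UnitAddTorus.mFourier, fourier_apply, ContinuousMap.coe_mk, norm_prod,
    Circle.norm_coe, Finset.prod_const_one]

theorem mFourier_add_apply (n : Fin d → ℤ) (x y : UnitAddTorus (Fin d)) :
    UnitAddTorus.mFourier n (x + y) = UnitAddTorus.mFourier n x * UnitAddTorus.mFourier n y := by
  simp [UnitAddTorus.mFourier, fourier_apply, smul_add, AddCircle.toCircle_add,
    Finset.prod_mul_distrib]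

theorem mFourier_toTorus (n : Fin d → ℤ) (x : Fin d → ℝ) :
    UnitAddTorus.mFourier n (toTorus 1 x) = (expTwoPi (∑ i, n i * x i) : ℂ) := by
  rw [expTwoPi_sum]
  simp only [UnitAddTorus.mFourier, ContinuousMap.coe_mk, toTorus, fourier_apply,
    AddCircle.toCircle_zsmul, toCircle_eq_expTwoPi, expTwoPi_intCast_mul]
  exact (map_prod Circle.coeHom (fun i => expTwoPi (x i) ^ n i) Finset.univ).symm

theorem integral_mFourier {n : Fin d → ℤ} (hn : n ≠ 0) :
    ∫ x, UnitAddTorus.mFourier n x = 0 := by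
  obtain ⟨i, hi⟩ := Function.ne_iff.mp hn
  have hi' : (n i : ℝ) ≠ 0 := by exact_mod_cast hi
  -- Translation by `y` multiplies the character by `e^{πi} = -1`, while it preserves the integral.
  let y : Fin d → ℝ := Pi.single i (1 / (2 * n i))
  have h1 : UnitAddTorus.mFourier n (toTorus 1 y) ≠ 1 := by
    rw [mFourier_toTorus]
    have h2 : ∑ j, (n j : ℝ) * y j = 1 / 2 := by
      rw [Finset.sum_eq_single i]
      · simp only [y, Pi.single_eq_same]; field_simp
      · intro j _ hj; simp [y, Pi.single_eq_of_ne hj]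
      · simp
    rw [h2]
    intro h
    obtain ⟨k, hk⟩ := (expTwoPi_eq_one_iff _).mp (Circle.ext (h.trans Circle.coe_one.symm))
    have h3 : (1 : ℝ) = ((2 * k : ℤ) : ℝ) := by push_cast; linarith
    have h4 : (1 : ℤ) = 2 * k := by exact_mod_cast h3
    omega
  have h2 := integral_add_right_eq_self (μ := (volume : Measure (UnitAddTorus (Fin d))))
    (fun x => UnitAddTorus.mFourier n x) (toTorus 1 y)
  simp only [mFourier_add_apply] at h2
  rw [integral_mul_const] at h2
  by_contra h0
  exact h1 (mul_left_cancel₀ h0 (h2.trans (mul_one _).symm))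

/-- Otherwise the character would be invariant, hence almost everywhere constant by ergodicity; its
zero mean then contradicts its modulus `1`. -/
theorem mFourier_ne_one_of_ergodic {α : Fin d → ℝ}
    (hα : Ergodic (fun θ : UnitAddTorus (Fin d) => θ + toTorus 1 α) volume)
    {n : Fin d → ℤ} (hn : n ≠ 0) : UnitAddTorus.mFourier n (toTorus 1 α) ≠ 1 := by
  intro h
  have h1 : (UnitAddTorus.mFourier n : UnitAddTorus (Fin d) → ℂ) ∘
      (fun θ : UnitAddTorus (Fin d) => θ + toTorus 1 α) = UnitAddTorus.mFourier n := by
    funext θ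
    rw [Function.comp_apply, mFourier_add_apply, h, mul_one]
  obtain ⟨c, hc⟩ := hα.ae_eq_const_of_ae_eq_comp
    (UnitAddTorus.mFourier n).continuous.measurable h1
  have h2 := integral_mFourier hn
  rw [integral_congr_ae hc] at h2
  simp only [Function.const_apply, integral_const, probReal_univ, one_smul] at h2
  obtain ⟨θ, hθ⟩ := hc.exists
  have h3 : ‖UnitAddTorus.mFourier n θ‖ = 1 := norm_mFourier_apply n θ
  rw [hθ, Function.const_apply, h2, norm_zero] at h3
  exact zero_ne_one h3

theorem tendsto_birkhoffAverage_mFourier {α : Fin d → ℝ}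
    (hα : Ergodic (fun θ : UnitAddTorus (Fin d) => θ + toTorus 1 α) volume) (n : Fin d → ℤ)
    (θ : UnitAddTorus (Fin d)) :
    Tendsto (fun N => birkhoffAverage ℂ (fun θ => θ + toTorus 1 α) (UnitAddTorus.mFourier n) N θ)
      atTop (𝓝 (∫ x, UnitAddTorus.mFourier n x)) := by
  set R : UnitAddTorus (Fin d) → UnitAddTorus (Fin d) := fun θ => θ + toTorus 1 α
  set z := UnitAddTorus.mFourier n (toTorus 1 α) with hz
  have hit : ∀ k, UnitAddTorus.mFourier n (R^[k] θ) = UnitAddTorus.mFourier n θ * z ^ k := by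
    intro k
    induction k with
    | zero => simp
    | succ k ih =>
      rw [Function.iterate_succ_apply', mFourier_add_apply, ih, pow_succ, mul_assoc]
  rcases eq_or_ne n 0 with rfl | hn
  · have h0 : Tendsto (fun _ : ℕ => (1 : ℂ)) atTop
        (𝓝 (∫ x, UnitAddTorus.mFourier (d := Fin d) 0 x)) := by
      simp [UnitAddTorus.mFourier_zero]
    refine h0.congr' ((eventually_gt_atTop 0).mono fun N hN => ?_)
    have : (N : ℂ) ≠ 0 := by exact_mod_cast hN.ne'
    simp [birkhoffAverage, birkhoffSum, UnitAddTorus.mFourier_zero, this]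
  · rw [integral_mFourier hn]
    have hz1 : z ≠ 1 := mFourier_ne_one_of_ergodic hα hn
    have hzn : ‖z‖ = 1 := norm_mFourier_apply n _
    have hθ : ‖UnitAddTorus.mFourier n θ‖ = 1 := norm_mFourier_apply n θ
    refine squeeze_zero_norm (a := fun N : ℕ => (2 / ‖z - 1‖) / N) (fun N => ?_)
      (tendsto_const_div_atTop_nhds_zero_nat _)
    -- A geometric sum with ratio `z ≠ 1` of modulus `1` stays bounded, so its average tends to `0`
    -- at every `θ`.
    have hg : birkhoffSum R (UnitAddTorus.mFourier n) N θ =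
        UnitAddTorus.mFourier n θ * ((z ^ N - 1) / (z - 1)) := by
      rw [birkhoffSum, ← geom_sum_eq hz1, Finset.mul_sum]
      exact Finset.sum_congr rfl fun k _ => hit k
    rw [birkhoffAverage, hg, norm_smul, norm_mul, hθ, one_mul, norm_div, norm_inv,
      Complex.norm_natCast, div_eq_inv_mul _ (N : ℝ)]
    gcongr
    refine (norm_sub_le _ _).trans ?_
    rw [norm_pow, hzn]
    norm_num

theorem norm_birkhoffAverage_le {Y : Type*} {T : Y → Y} {f : Y → ℂ} {M : ℝ} (hM : 0 ≤ M)
    (hf : ∀ y, ‖f y‖ ≤ M) (n : ℕ) (y : Y) : ‖birkhoffAverage ℂ T f n y‖ ≤ M := by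
  rw [birkhoffAverage, norm_smul, norm_inv, Complex.norm_natCast]
  have h1 : ‖birkhoffSum T f n y‖ ≤ n * M :=
    (norm_sum_le _ _).trans ((Finset.sum_le_sum fun k _ => hf _).trans (by simp))
  rcases n.eq_zero_or_pos with rfl | hn
  · simpa using hM
  · have hn' : (0 : ℝ) < n := by exact_mod_cast hn
    rwa [inv_mul_le_iff₀ hn']

/-- Equidistribution of the orbits of an ergodic rotation of the torus. -/
theorem tendsto_birkhoffAverage_rotation {α : Fin d → ℝ}
    (hα : Ergodic (fun θ : UnitAddTorus (Fin d) => θ + toTorus 1 α) volume)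
    (g : C(UnitAddTorus (Fin d), ℂ)) (θ : UnitAddTorus (Fin d)) :
    Tendsto (fun N => birkhoffAverage ℂ (fun θ => θ + toTorus 1 α) g N θ)
      atTop (𝓝 (∫ x, g x)) := by
  have hint : ∀ p : C(UnitAddTorus (Fin d), ℂ), Integrable p volume := fun p =>
    p.continuous.integrable_of_hasCompactSupport (HasCompactSupport.of_compactSpace _)
  have hspan : ∀ p ∈ Submodule.span ℂ (Set.range (UnitAddTorus.mFourier (d := Fin d))),
      Tendsto (fun N => birkhoffAverage ℂ (fun θ => θ + toTorus 1 α) p N θ)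
        atTop (𝓝 (∫ x, p x)) := by
    intro p hp
    induction hp using Submodule.span_induction with
    | mem p hp =>
      obtain ⟨n, rfl⟩ := hp
      exact tendsto_birkhoffAverage_mFourier hα n θ
    | zero => simp [birkhoffAverage, birkhoffSum]
    | add p q _ _ hp hq =>
      have h1 : ∫ x, (p + q) x = (∫ x, p x) + ∫ x, q x := integral_add (hint p) (hint q)
      rw [h1]
      refine (hp.add hq).congr fun N => ?_
      simp [birkhoffAverage, birkhoffSum, Finset.sum_add_distrib, mul_add]
    | smul c p _ hp =>
      have h1 : ∫ x, (c • p) x = c * ∫ x, p x := integral_const_mul c _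
      rw [h1]
      refine (hp.const_mul c).congr fun N => ?_
      simp [birkhoffAverage, birkhoffSum, Finset.mul_sum, mul_left_comm]
  -- Trigonometric polynomials are uniformly dense, and both averages and integral are contractions
  -- for the sup norm.
  have hmem : g ∈ closure
      (Submodule.span ℂ (Set.range (UnitAddTorus.mFourier (d := Fin d))) : Set _) := by
    rw [← Submodule.topologicalClosure_coe, UnitAddTorus.span_mFourier_closure_eq_top]
    trivial
  refine Metric.tendsto_atTop.mpr fun ε hε => ?_
  obtain ⟨p, hp, hgp⟩ := Metric.mem_closure_iff.mp hmem (ε / 3) (by positivity)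
  obtain ⟨N₀, hN₀⟩ := Metric.tendsto_atTop.mp (hspan p hp) (ε / 3) (by positivity)
  refine ⟨N₀, fun N hN => ?_⟩
  have hb : ∀ x, ‖g x - p x‖ ≤ ε / 3 := fun x => by
    rw [← dist_eq_norm]
    exact (ContinuousMap.dist_apply_le_dist x).trans hgp.le
  have h1 : dist (birkhoffAverage ℂ (fun θ => θ + toTorus 1 α) g N θ)
      (birkhoffAverage ℂ (fun θ => θ + toTorus 1 α) p N θ) ≤ ε / 3 := by
    rw [dist_eq_norm]
    have : birkhoffAverage ℂ (fun θ => θ + toTorus 1 α) g N θ -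
        birkhoffAverage ℂ (fun θ => θ + toTorus 1 α) p N θ =
        birkhoffAverage ℂ (fun θ => θ + toTorus 1 α) (fun x => g x - p x) N θ := by
      simp [birkhoffAverage, birkhoffSum, mul_sub]
    rw [this]
    exact norm_birkhoffAverage_le (by positivity) hb N θ
  have h2 : dist (∫ x, p x) (∫ x, g x) ≤ ε / 3 := by
    rw [dist_comm, dist_eq_norm, ← integral_sub (hint g) (hint p)]
    refine (norm_integral_le_of_norm_le_const (Eventually.of_forall hb)).trans ?_
    simp
  have h3 := hN₀ N hN
  have h4 := dist_triangle4 (birkhoffAverage ℂ (fun θ => θ + toTorus 1 α) g N θ)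
    (birkhoffAverage ℂ (fun θ => θ + toTorus 1 α) p N θ) (∫ x, p x) (∫ x, g x)
  linarith

theorem tendsto_birkhoffAverage_rotation_real {α : Fin d → ℝ}
    (hα : Ergodic (fun θ : UnitAddTorus (Fin d) => θ + toTorus 1 α) volume)
    (g : C(UnitAddTorus (Fin d), ℝ)) (θ : UnitAddTorus (Fin d)) :
    Tendsto (fun N => birkhoffAverage ℝ (fun θ => θ + toTorus 1 α) g N θ)
      atTop (𝓝 (∫ x, g x)) := by
  have h := tendsto_birkhoffAverage_rotation hα ⟨fun x => (g x : ℂ), by fun_prop⟩ θ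
  simp only [ContinuousMap.coe_mk] at h
  rw [integral_complex_ofReal] at h
  have h2 := (Complex.continuous_re.tendsto _).comp h
  rw [Complex.ofReal_re] at h2
  refine h2.congr fun N => ?_
  have : birkhoffAverage ℂ (fun θ => θ + toTorus 1 α) (fun x => (g x : ℂ)) N θ =
      ((birkhoffAverage ℝ (fun θ => θ + toTorus 1 α) g N θ : ℝ) : ℂ) := by
    simp [birkhoffAverage, birkhoffSum]
  rw [Function.comp_apply]
  exact (congrArg Complex.re this).trans (Complex.ofReal_re _)

end Rotation

/-! ### Angles, lifts and the rotation number -/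

variable {d : ℕ}

attribute [local irreducible] act detU kappa

theorem _root_.Continuous.act {X : Type*} [TopologicalSpace X] {g : X → HSp m} {W : X → UG m}
    (hg : Continuous g) (hW : Continuous W) : Continuous fun x => act (g x) (W x) :=
  (continuous_act (m := m)).comp (hg.prodMk hW)

/-- The skew product `(θ, W) ↦ (θ + α, A(θ) W)` on `𝕋^d × U(m)`. -/
def skew (α : Fin d → ℝ) (A : C(Torus d 1, HSp m)) (p : Torus d 1 × UG m) : Torus d 1 × UG m :=
  (p.1 + toTorus 1 α, act (A p.1) p.2)

/-- `f` is a continuous argument of the determinant cocycle of `A`. -/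
def IsAngle (A : C(Torus d 1, HSp m)) (f : C(Torus d 1 × UG m, ℝ)) : Prop :=
  ∀ θ W, detU (act (A θ) W) = detU W * expTwoPi (f (θ, W))

/-- `kappa ∘ A` is homotopic to a constant and therefore lifts to `ℝ`; the remaining factor of the
cocycle already has the argument `E`. -/
theorem exists_isAngle {A : C(Torus d 1, HSp m)} (hA : A.Homotopic (ContinuousMap.const _ 1)) :
    ∃ f, IsAngle A f := by
  obtain ⟨E, -, -, hE⟩ := exists_bounded_arg m
  let κ : C(HSp m, Circle) := ⟨kappa, continuous_kappa⟩
  obtain ⟨x₀, hx₀⟩ := expTwoPi_surjective (kappa (1 : HSp m))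
  obtain ⟨k, hk⟩ := exists_lift_of_homotopic_lift
    (((ContinuousMap.Homotopic.refl κ).comp hA).symm) (ContinuousMap.const _ x₀)
    (fun _ => hx₀.symm)
  refine ⟨⟨fun p => k p.1 + E (A p.1, p.2), by fun_prop⟩, fun θ W => ?_⟩
  have h1 : kappa (A θ) = expTwoPi (k θ) := hk θ
  rw [hE, h1, mul_assoc, ← expTwoPi_add]
  rfl

/-- The projection of the covering space to `𝕋^d × U(m)`. -/
def proj (q : CoverSpace d m) : Torus d 1 × UG m := (q.1, coverU q.2.1 q.2.2)

theorem continuous_proj : Continuous (proj : CoverSpace d m → _) :=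
  continuous_fst.prodMk (continuous_coverU.comp continuous_snd)

theorem continuous_skew (α : Fin d → ℝ) (A : C(Torus d 1, HSp m)) : Continuous (skew α A) :=
  (continuous_fst.add continuous_const).prodMk
    ((A.continuous.comp continuous_fst).act continuous_snd)

theorem IsAngle.exists_isLift {A : C(Torus d 1, HSp m)} {f : C(Torus d 1 × UG m, ℝ)}
    (hf : IsAngle A f) (hm : 0 < m) (α : Fin d → ℝ) : ∃ F, IsLift α A F := by
  have hm' : (m : ℝ) ≠ 0 := by exact_mod_cast hm.ne'
  have h : ∀ q : CoverSpace d m,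
      detU (skew α A (proj q)).2 = expTwoPi (m * (q.2.1 + f (proj q) / m)) := by
    intro q
    rw [mul_add, mul_div_cancel₀ _ hm', expTwoPi_add, ← detU_coverU]
    exact hf _ _
  choose S hS hS' using fun q : CoverSpace d m => exists_coverU_eq (h q)
  have hpc := continuous_proj (d := d) (m := m)
  have hS_cont : Continuous S := by
    refine continuous_induced_rng.mpr ?_
    have : (Subtype.val ∘ S : CoverSpace d m → Matrix (Fin m) (Fin m) ℂ) = _ := funext hS
    rw [this]
    have h1 : Continuous fun q : CoverSpace d m =>
        ((skew α A (proj q)).2 : Matrix (Fin m) (Fin m) ℂ) :=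
      continuous_subtype_val.comp (continuous_snd.comp ((continuous_skew α A).comp hpc))
    have h2 : Continuous fun q : CoverSpace d m => -(q.2.1 + f (proj q) / m) := by fun_prop
    exact (continuous_subtype_val.comp (continuous_expTwoPi.comp h2)).smul h1
  -- The determinant of `e^{2πix} S` is `e^{2πimx}`, so an angle `f` for the determinant moves `x`
  -- by `f / m`.
  refine ⟨fun q => (q.1 + toTorus 1 α, q.2.1 + f (proj q) / m, S q), ?_, fun θ x S => rfl, ?_, ?_⟩
  · fun_prop
  · intro θ x s L hL hxL
    rw [lagW_mul (W := coverU x s) hL hxL]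
    exact congrArg Subtype.val (hS' (θ, x, s))
  · intro θ x s x' s' hxx
    have : coverU x s = coverU x' s' := Subtype.ext hxx
    simp [proj, this]

theorem IsLift.proj_apply {α : Fin d → ℝ} {A : C(Torus d 1, HSp m)}
    {F : CoverSpace d m → CoverSpace d m} (hF : IsLift α A F) (q : CoverSpace d m) :
    proj (F q) = skew α A (proj q) := by
  obtain ⟨θ, x, S⟩ := q
  obtain ⟨L, hL, hW⟩ := exists_frame (coverU x S)
  refine Prod.ext (hF.base θ x S) (Subtype.ext ?_)
  have h1 := hF.covers θ x S L hL hW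
  rw [lagW_mul hL hW] at h1
  exact h1

/-- Displacement and angle are continuous arguments of one determinant cocycle, so they differ by an
integer, constant on the connected covering space. Hence the choice of lift does not matter modulo
`ℤ`. -/
theorem IsAngle.exists_displacement_eq {A : C(Torus d 1, HSp m)} {f : C(Torus d 1 × UG m, ℝ)}
    (hf : IsAngle A f) (hm : 0 < m) {α : Fin d → ℝ} {F : CoverSpace d m → CoverSpace d m}
    (hF : IsLift α A F) : ∃ k : ℤ, ∀ q, displacement F q = f (proj q) + k := by
  have := connectedSpace_specialUnitary hm
  have hpc := continuous_proj (d := d) (m := m)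
  have hFc := hF.continuous
  have h1 : ∀ q, expTwoPi (displacement F q - f (proj q)) = 1 := by
    intro q
    have h2 : detU (proj (F q)).2 = detU (proj q).2 * expTwoPi (f (proj q)) := by
      rw [hF.proj_apply]; exact hf _ _
    change detU (coverU _ _) = detU (coverU _ _) * _ at h2
    rw [detU_coverU, detU_coverU] at h2
    rw [displacement, mul_sub, expTwoPi_sub, expTwoPi_sub, h2, mul_div_cancel_left, div_self']
  have hcont : Continuous fun q => displacement F q - f (proj q) := by
    unfold displacement
    fun_prop
  let q₀ : CoverSpace d m := (0, 0, 1)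
  obtain ⟨k, hk⟩ := (expTwoPi_eq_one_iff _).mp (h1 q₀)
  refine ⟨k, fun q => ?_⟩
  have := eq_of_expTwoPi_comp_const hcont (fun x y => (h1 x).trans (h1 y).symm) q q₀
  linarith

theorem IsAngle.isFiberedRotationNumber {A : C(Torus d 1, HSp m)} {f : C(Torus d 1 × UG m, ℝ)}
    (hf : IsAngle A f) (hm : 0 < m) {α : Fin d → ℝ} {t : ℝ}
    (ht : ∀ p, Tendsto (fun n : ℕ => birkhoffAverage ℝ (skew α A) f n p) atTop (𝓝 t)) :
    IsFiberedRotationNumber α A (t : UnitAddCircle) := by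
  refine ⟨hf.exists_isLift hm α, fun F hF => ?_⟩
  obtain ⟨k, hk⟩ := hf.exists_displacement_eq hm hF
  refine ⟨t + k, ?_, Eventually.of_forall fun θ x S => ?_⟩
  · rw [AddCircle.coe_add]
    have : ((k : ℝ) : UnitAddCircle) = 0 := (AddCircle.coe_eq_zero_iff 1).mpr ⟨k, by simp⟩
    rw [this, add_zero]
  · refine ((ht (proj (θ, x, S))).add_const (k : ℝ)).congr'
      ((eventually_gt_atTop 0).mono fun n hn => ?_)
    have hn' : (n : ℝ) ≠ 0 := by exact_mod_cast hn.ne'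
    have hsemi : Function.Semiconj proj F (skew α A) := hF.proj_apply
    simp only [birkhoffAverage, birkhoffSum, hk, Finset.sum_add_distrib, smul_eq_mul, mul_add,
      (hsemi.iterate_right _).eq]
    simp [hn']

/-- Since iteration in the fibre is the action of one element, the bound on `E`, which is uniform
over the group, applies to all times at once. -/
theorem exists_skew_iterate (α : Fin d → ℝ) (A : C(Torus d 1, HSp m)) (θ : Torus d 1) (n : ℕ) :
    ∃ g : HSp m, ∀ W, ((skew α A)^[n] (θ, W)).2 = act g W := by
  induction n generalizing θ with
  | zero => exact ⟨1, fun W => (act_one W).symm⟩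
  | succ n ih =>
    obtain ⟨g, hg⟩ := ih (θ + toTorus 1 α)
    exact ⟨g * A θ, fun W => by rw [Function.iterate_succ_apply, act_mul]; exact hg _⟩

theorem IsAngle.detU_iterate {A : C(Torus d 1, HSp m)} {f : C(Torus d 1 × UG m, ℝ)}
    (hf : IsAngle A f) (α : Fin d → ℝ) (n : ℕ) (p : Torus d 1 × UG m) :
    detU ((skew α A)^[n] p).2 = detU p.2 * expTwoPi (birkhoffSum (skew α A) f n p) := by
  induction n with
  | zero => simp [expTwoPi_zero]
  | succ n ih =>
    rw [Function.iterate_succ_apply', birkhoffSum_succ, expTwoPi_add, ← mul_assoc, ← ih]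
    exact hf _ _

/-- For the element `g` of the `n`-step map, the Birkhoff sum minus `E (g, ·)` is an argument of the
constant `kappa g`, hence constant on the connected group `U(m)`. The sum thus oscillates in `W` no
more than `E` does. -/
theorem IsAngle.exists_abs_birkhoffSum_sub_le {A : C(Torus d 1, HSp m)}
    {f : C(Torus d 1 × UG m, ℝ)} (hf : IsAngle A f) (α : Fin d → ℝ) :
    ∃ C : ℝ, ∀ n θ W W',
      |birkhoffSum (skew α A) f n (θ, W) - birkhoffSum (skew α A) f n (θ, W')| ≤ C := by
  obtain ⟨E, C, hb, hE⟩ := exists_bounded_arg m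
  refine ⟨C + C, fun n θ W W' => ?_⟩
  obtain ⟨g, hg⟩ := exists_skew_iterate α A θ n
  have hs := continuous_skew α A
  have hcont : Continuous fun W => birkhoffSum (skew α A) f n (θ, W) - E (g, W) := by
    refine Continuous.sub ?_ (by fun_prop)
    exact continuous_finsetSum _ fun k _ =>
      f.continuous.comp ((hs.iterate k).comp (by fun_prop))
  have hκ : ∀ W, expTwoPi (birkhoffSum (skew α A) f n (θ, W) - E (g, W)) = kappa g := by
    intro W
    have h1 := hf.detU_iterate α n (θ, W)
    rw [hg, hE, mul_assoc] at h1
    rw [expTwoPi_sub, ← mul_left_cancel h1, mul_div_cancel_right]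
  have h2 := eq_of_expTwoPi_comp_const hcont (fun x y => (hκ x).trans (hκ y).symm) W W'
  have h3 : birkhoffSum (skew α A) f n (θ, W) - birkhoffSum (skew α A) f n (θ, W') =
      E (g, W) - E (g, W') := by linarith
  rw [h3]
  exact (abs_sub _ _).trans (add_le_add (hb _) (hb _))

section Compact

open scoped Matrix.Norms.Elementwise

instance : CompactSpace (UG m) := by
  refine isCompact_iff_compactSpace.mp (Metric.isCompact_of_isClosed_isBounded ?_ ?_)
  · have : (Matrix.unitaryGroup (Fin m) ℂ : Set (Matrix (Fin m) (Fin m) ℂ)) =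
        {M | M * star M = 1} := Set.ext fun M => Matrix.mem_unitaryGroup_iff
    rw [this]
    exact isClosed_eq (by fun_prop) continuous_const
  · refine (Metric.isBounded_closedBall (x := 0) (r := 1)).subset fun M hM => ?_
    rw [mem_closedBall_zero_iff]
    exact entrywise_sup_norm_bound_of_unitary hM

end Compact

theorem IsAngle.exists_tendsto {A : C(Torus d 1, HSp m)} {f : C(Torus d 1 × UG m, ℝ)}
    (hf : IsAngle A f) {α : Fin d → ℝ}
    (hα : Ergodic (fun θ : UnitAddTorus (Fin d) => θ + toTorus 1 α) volume) :
    ∃ t : ℝ, ∀ p, Tendsto (fun n : ℕ => birkhoffAverage ℝ (skew α A) f n p) atTop (𝓝 t) := by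
  obtain ⟨C, hC⟩ := hf.exists_abs_birkhoffSum_sub_le α
  have hs := continuous_skew α A
  -- The sums over the reference point `W = 1` serve as functions of `θ` alone; any other `W` costs
  -- at most `C`.
  let g : ℕ → C(UnitAddTorus (Fin d), ℝ) := fun N =>
    ⟨fun θ => birkhoffSum (skew α A) f N (θ, 1), continuous_finsetSum _ fun k _ =>
      f.continuous.comp ((hs.iterate k).comp (by fun_prop))⟩
  exact exists_tendsto_birkhoffAverage (R := fun θ : UnitAddTorus (Fin d) => θ + toTorus 1 α)
    (p := Prod.fst) (fun _ => rfl) (fun p => f.norm_coe_le_norm p) (g := fun N => g N)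
    (fun N θ => tendsto_birkhoffAverage_rotation_real hα (g N) θ) (C := C)
    (fun N p => hC N p.1 p.2 1)

/-! ### Conjugation over `ℝ^d` -/

theorem isOpenQuotientMap_toTorus (p : ℝ) :
    IsOpenQuotientMap (toTorus p : (Fin d → ℝ) → Torus d p) :=
  IsOpenQuotientMap.piMap fun _ => QuotientAddGroup.isOpenQuotientMap_mk

theorem toTorus_add (p : ℝ) (x y : Fin d → ℝ) : toTorus p (x + y) = toTorus p x + toTorus p y :=
  rfl

theorem exists_int_of_toTorus_eq {x y : Fin d → ℝ} (h : toTorus 1 x = toTorus 1 y) :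
    ∃ k : Fin d → ℤ, x = y + fun i => (k i : ℝ) := by
  have h1 : ∀ i, ∃ k : ℤ, x i = y i + k := fun i => by
    have h2 : ((x i : ℝ) : AddCircle (1 : ℝ)) = (y i : ℝ) := congrFun h i
    rw [← sub_eq_zero, ← AddCircle.coe_sub] at h2
    obtain ⟨k, hk⟩ := (AddCircle.coe_eq_zero_iff 1).mp h2
    exact ⟨k, by simp at hk; linarith⟩
  choose k hk using h1
  exact ⟨k, funext hk⟩

theorem toTorus_intCast (k : Fin d → ℤ) : toTorus 1 (fun i => (k i : ℝ)) = 0 :=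
  funext fun i => (AddCircle.coe_eq_zero_iff 1).mpr ⟨k i, by simp⟩

/-- A cocycle conjugated over `ℝ^d` to a cocycle with an angle has an angle, which is cohomologous
to the original one up to `-⟨β, α⟩`. -/
theorem IsAngle.exists_conj {A D : C(Torus d 1, HSp m)} {f : C(Torus d 1 × UG m, ℝ)}
    (hf : IsAngle A f) {α : Fin d → ℝ} {B : C(Fin d → ℝ, HSp m)}
    (hD : ∀ x, D (toTorus 1 x) = (B (x + α))⁻¹ * A (toTorus 1 x) * B x)
    {β : Fin d → ℝ} {u : C(Fin d → ℝ, ℝ)} {K : ℝ} (hu : ∀ x, |u x| ≤ K)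
    (hκ : ∀ x, kappa (B x) = expTwoPi (∑ i, β i * x i + u x)) :
    ∃ (g : C(Torus d 1 × UG m, ℝ)) (ψ : (Fin d → ℝ) × UG m → ℝ) (M : ℝ), IsAngle D g ∧
      (∀ p, |ψ p| ≤ M) ∧ ∀ x W, g (toTorus 1 x, W) = f (toTorus 1 x, act (B x) W) +
        ψ (x, W) - ψ (x + α, act (D (toTorus 1 x)) W) - ∑ i, β i * α i := by
  obtain ⟨E, C, hb, hE⟩ := exists_bounded_arg m
  -- The bounded part of the argument of `det (B(x) W) / det W`; the unbounded part is the linear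
  -- form `⟨β, x⟩`.
  let ψ : (Fin d → ℝ) × UG m → ℝ := fun p => u p.1 + E (B p.1, p.2)
  have hψb : ∀ p, |ψ p| ≤ K + C := fun p =>
    (abs_add_le _ _).trans (add_le_add (hu _) (hb _))
  have hψ : ∀ x W, detU (act (B x) W) = detU W * expTwoPi (∑ i, β i * x i + ψ (x, W)) := by
    intro x W
    rw [hE, hκ, mul_assoc, ← expTwoPi_add, add_assoc]
  let G : (Fin d → ℝ) × UG m → ℝ := fun p => f (toTorus 1 p.1, act (B p.1) p.2) +
    ψ p - ψ (p.1 + α, act (D (toTorus 1 p.1)) p.2) - ∑ i, β i * α i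
  have htc : Continuous (toTorus 1 : (Fin d → ℝ) → Torus d 1) :=
    (isOpenQuotientMap_toTorus 1).continuous
  have hψc : Continuous ψ := by fun_prop
  have hGc : Continuous G := by
    have h1 : Continuous fun p : (Fin d → ℝ) × UG m => act (B p.1) p.2 :=
      (B.continuous.comp continuous_fst).act continuous_snd
    have h2 : Continuous fun p : (Fin d → ℝ) × UG m => act (D (toTorus 1 p.1)) p.2 :=
      (D.continuous.comp (htc.comp continuous_fst)).act continuous_snd
    fun_prop
  have hG : ∀ x W, detU (act (D (toTorus 1 x)) W) = detU W * expTwoPi (G (x, W)) := by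
    intro x W
    -- The determinants of both sides of the conjugacy relation are compared; the linear forms at
    -- `x` and `x + α` differ by `⟨β, α⟩`.
    have h1 : act (B (x + α)) (act (D (toTorus 1 x)) W) = act (A (toTorus 1 x)) (act (B x) W) := by
      rw [← act_mul, ← act_mul, hD]
      congr 1
      group
    have h2 := congrArg detU h1
    rw [hψ, hf, hψ, mul_assoc, ← expTwoPi_add, ← eq_div_iff_mul_eq', mul_div_assoc,
      ← expTwoPi_sub] at h2
    rw [h2]
    congr 2
    have h3 : ∑ i, β i * (x + α) i = ∑ i, β i * x i + ∑ i, β i * α i := by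
      simp [mul_add, Finset.sum_add_distrib]
    simp only [G, h3]
    ring
  have hGb : ∀ p, |G p| ≤ ‖f‖ + (K + C) + (K + C) + |∑ i, β i * α i| := by
    intro p
    refine (abs_sub _ _).trans (add_le_add ((abs_sub _ _).trans (add_le_add
      ((abs_add_le _ _).trans (add_le_add (f.norm_coe_le_norm _) (hψb _))) (hψb _))) le_rfl)
  -- The target of `G` is periodic, so `G (x + v) - G x` is integer valued, hence a constant `c`.
  -- Iteration gives growth `n c`, which boundedness of `G` forbids unless `c = 0`. Periodicity of
  -- `B` or `u` is not needed.
  have hper : ∀ (k : Fin d → ℤ) x W, G (x + (fun i => (k i : ℝ)), W) = G (x, W) := by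
    intro k x W
    set v : Fin d → ℝ := fun i => (k i : ℝ) with hv
    have htv : ∀ x, toTorus 1 (x + v) = toTorus 1 x := fun x => by
      rw [toTorus_add, toTorus_intCast, add_zero]
    have h1 : ∀ x, expTwoPi (G (x + v, W) - G (x, W)) = 1 := by
      intro x
      have h2 := hG (x + v) W
      rw [htv, hG] at h2
      rw [expTwoPi_sub, mul_left_cancel h2, div_self']
    have h3 : ∀ y, G (y + v, W) - G (y, W) = G (x + v, W) - G (x, W) := fun y =>
      eq_of_expTwoPi_comp_const (f := fun y => G (y + v, W) - G (y, W)) (by fun_prop)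
        (fun a b => (h1 a).trans (h1 b).symm) y x
    set c := G (x + v, W) - G (x, W) with hc
    have h4 : ∀ n : ℕ, G (x + n • v, W) = G (x, W) + n * c := by
      intro n
      induction n with
      | zero => simp
      | succ n ih =>
        have := h3 (x + n • v)
        rw [succ_nsmul, ← add_assoc]
        push_cast
        linarith
    have h5 : c = 0 := by
      by_contra h0
      obtain ⟨n, hn⟩ := exists_nat_gt
        ((2 * (‖f‖ + (K + C) + (K + C) + |∑ i, β i * α i|)) / |c|)
      rw [div_lt_iff₀ (abs_pos.mpr h0)] at hn
      have h6 := hGb (x + n • v, W)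
      have h7 := hGb (x, W)
      have h8 : (n : ℝ) * |c| = |G (x + n • v, W) - G (x, W)| := by
        rw [h4, add_sub_cancel_left, abs_mul, Nat.abs_cast]
      rw [h8] at hn
      have := abs_sub (G (x + n • v, W)) (G (x, W))
      linarith
    linarith
  have hq : IsOpenQuotientMap
      (Prod.map (toTorus 1) id : (Fin d → ℝ) × UG m → Torus d 1 × UG m) :=
    (isOpenQuotientMap_toTorus 1).prodMap IsOpenQuotientMap.id
  have hfac : Function.FactorsThrough (⟨G, hGc⟩ : C((Fin d → ℝ) × UG m, ℝ))
      (⟨Prod.map (toTorus 1) id, hq.continuous⟩ : C((Fin d → ℝ) × UG m, Torus d 1 × UG m)) := by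
    rintro ⟨x, W⟩ ⟨y, W'⟩ h
    obtain ⟨h1, h2⟩ := Prod.ext_iff.mp h
    obtain ⟨k, rfl⟩ := exists_int_of_toTorus_eq h1
    obtain rfl : W = W' := h2
    exact hper k y W
  have hq' : IsQuotientMap
      (⟨Prod.map (toTorus 1) id, hq.continuous⟩ : C((Fin d → ℝ) × UG m, Torus d 1 × UG m)) :=
    hq.isQuotientMap
  let g := hq'.lift ⟨G, hGc⟩ hfac
  have hg : ∀ x W, g (toTorus 1 x, W) = G (x, W) := fun x W =>
    DFunLike.congr_fun (hq'.lift_comp ⟨G, hGc⟩ hfac) (x, W)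
  refine ⟨g, ψ, K + C, fun θ W => ?_, hψb, hg⟩
  obtain ⟨x, rfl⟩ := (isOpenQuotientMap_toTorus 1).surjective θ
  rw [hg, hG]

/-- The rotation number of a conjugated cocycle. -/
theorem IsAngle.isFiberedRotationNumber_conj {A D : C(Torus d 1, HSp m)}
    {f : C(Torus d 1 × UG m, ℝ)} (hf : IsAngle A f) (hm : 0 < m) {α : Fin d → ℝ}
    (hα : Ergodic (fun θ : UnitAddTorus (Fin d) => θ + toTorus 1 α) volume) {t : ℝ}
    (ht : ∀ p, Tendsto (fun n : ℕ => birkhoffAverage ℝ (skew α A) f n p) atTop (𝓝 t))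
    {B : C(Fin d → ℝ, HSp m)}
    (hD : ∀ x, D (toTorus 1 x) = (B (x + α))⁻¹ * A (toTorus 1 x) * B x)
    {β : Fin d → ℝ} {u : C(Fin d → ℝ, ℝ)} {K : ℝ} (hu : ∀ x, |u x| ≤ K)
    (hκ : ∀ x, kappa (B x) = expTwoPi (∑ i, β i * x i + u x)) :
    IsFiberedRotationNumber α D ((t : UnitAddCircle) - ((∑ i, β i * α i : ℝ) : UnitAddCircle)) := by
  obtain ⟨g, ψ, M, hg, hψ, hgf⟩ := hf.exists_conj hD hu hκ
  obtain ⟨s, hs⟩ := hg.exists_tendsto hα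
  -- The coboundary telescopes. The endpoint `p` is left unspecified since only the bound on `ψ`
  -- matters there.
  have hsum : ∀ (n : ℕ) x W, ∃ p, birkhoffSum (skew α D) g n (toTorus 1 x, W) =
      birkhoffSum (skew α A) f n (toTorus 1 x, act (B x) W) + ψ (x, W) - ψ p -
        n * ∑ i, β i * α i := by
    intro n
    induction n with
    | zero => exact fun x W => ⟨(x, W), by simp⟩
    | succ n ih =>
      intro x W
      obtain ⟨p, hp⟩ := ih (x + α) (act (D (toTorus 1 x)) W)
      refine ⟨p, ?_⟩
      have h1 : act (B (x + α)) (act (D (toTorus 1 x)) W) =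
          act (A (toTorus 1 x)) (act (B x) W) := by
        rw [← act_mul, ← act_mul, hD]
        congr 1
        group
      rw [h1] at hp
      rw [birkhoffSum_succ', birkhoffSum_succ', hgf]
      have h2 : skew α D (toTorus 1 x, W) = (toTorus 1 (x + α), act (D (toTorus 1 x)) W) := rfl
      have h3 : skew α A (toTorus 1 x, act (B x) W) =
        (toTorus 1 (x + α), act (A (toTorus 1 x)) (act (B x) W)) := rfl
      rw [h2, h3, hp]
      push_cast
      ring
  have hst : s = t - ∑ i, β i * α i := by
    refine tendsto_nhds_unique (hs (toTorus 1 0, 1)) ?_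
    have h1 := (ht (toTorus 1 0, act (B 0) 1)).sub_const (∑ i, β i * α i)
    have h2 : Tendsto (fun n : ℕ => birkhoffAverage ℝ (skew α D) g n (toTorus 1 0, 1) -
        (birkhoffAverage ℝ (skew α A) f n (toTorus 1 0, act (B 0) 1) - ∑ i, β i * α i))
        atTop (𝓝 0) := by
      refine squeeze_zero_norm' (a := fun n : ℕ => (2 * M) / n)
        ((eventually_gt_atTop 0).mono fun n hn => ?_) (tendsto_const_div_atTop_nhds_zero_nat _)
      have hn' : (0 : ℝ) < n := by exact_mod_cast hn
      obtain ⟨p, hp⟩ := hsum n 0 1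
      have h3 : birkhoffAverage ℝ (skew α D) g n (toTorus 1 0, 1) -
          (birkhoffAverage ℝ (skew α A) f n (toTorus 1 0, act (B 0) 1) - ∑ i, β i * α i) =
          (ψ (0, 1) - ψ p) / n := by
        rw [birkhoffAverage, birkhoffAverage, hp, smul_eq_mul, smul_eq_mul]
        field_simp
        ring
      rw [h3, Real.norm_eq_abs, abs_div, abs_of_pos hn']
      gcongr
      refine (abs_sub _ _).trans ?_
      linarith [hψ (0, 1), hψ p]
    simpa using h2.add h1
  have := hg.isFiberedRotationNumber hm hs
  rwa [hst, AddCircle.coe_sub] at this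

theorem character_toTorus (r : Fin d → ℤ) (x : Fin d → ℝ) :
    character r (toTorus 1 x) = expTwoPi (∑ i, (r i : ℝ) * x i) := by
  rw [expTwoPi_sum]
  simp_rw [expTwoPi_intCast_mul, ← toCircle_eq_expTwoPi]
  rfl

/-- Dividing by the character makes `kappa ∘ B` null-homotopic, so the quotient has an argument on
the compact torus, automatically bounded. -/
theorem HasDegree.exists_arg {B : C(Torus d 1, HSp m)} {r : Fin d → ℤ} (h : HasDegree B r) :
    ∃ u : C(Torus d 1, ℝ), ∀ θ, kappa (B θ) = character r θ * expTwoPi (u θ) := by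
  obtain ⟨P, U₁, U₂, h, hP, hh, ⟨H⟩⟩ := h
  have hκ : ∀ θ, h θ = kappa (B θ) := fun θ => (hP θ).kappa_eq (hh θ)
  have hhom : (h / character r).Homotopic (ContinuousMap.const _ 1) :=
    ⟨{ toFun := fun p => H p / character r p.2
       continuous_toFun := by fun_prop
       map_zero_left := fun θ => by simp
       map_one_left := fun θ => by simp }⟩
  obtain ⟨u, hu⟩ := exists_lift_of_homotopic_lift hhom.symm (ContinuousMap.const _ 0)
    (fun θ => expTwoPi_zero.symm)
  refine ⟨u, fun θ => ?_⟩
  rw [← hu, ← hκ]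
  simp

theorem double_toTorus (x : Fin d → ℝ) :
    double d (toTorus 1 fun i => x i / 2) = toTorus 2 x := by
  funext i
  change AddCircle.homeomorphAddCircle (1 : ℝ) 2 one_ne_zero two_ne_zero
    ((x i / 2 : ℝ) : AddCircle (1 : ℝ)) = _
  rw [AddCircle.homeomorphAddCircle_apply_mk]
  simp [toTorus]

end HSpCocycle

end

/-! ### The proposition -/

theorem mainTheorem6 (d m : ℕ) (hm : 0 < m) (α : Fin d → ℝ)
    (hα : Ergodic (fun θ : UnitAddTorus (Fin d) => θ + HSpCocycle.toTorus 1 α)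
      (MeasureTheory.volume : MeasureTheory.Measure (UnitAddTorus (Fin d))))
    (A : C(HSpCocycle.Torus d 1, HSpCocycle.HSp m))
    (hA : A.Homotopic (ContinuousMap.const _ 1)) :
    ∃ ρ : UnitAddCircle, HSpCocycle.IsFiberedRotationNumber α A ρ ∧
      (∀ (B : C(HSpCocycle.Torus d 1, HSpCocycle.HSp m)) (r : Fin d → ℤ),
        HSpCocycle.HasDegree B r →
        HSpCocycle.IsFiberedRotationNumber α (HSpCocycle.conjugate α A B)
          (ρ - ((∑ i, (r i : ℝ) * α i : ℝ) : UnitAddCircle))) ∧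
      (∀ (B : C(HSpCocycle.Torus d 2, HSpCocycle.HSp m)) (r : Fin d → ℤ),
        HSpCocycle.HasDegree (B.comp (HSpCocycle.double d)) r →
        ∀ D : C(HSpCocycle.Torus d 1, HSpCocycle.HSp m),
          (∀ x : Fin d → ℝ, D (HSpCocycle.toTorus 1 x) =
            (B (HSpCocycle.toTorus 2 (x + α)))⁻¹ * A (HSpCocycle.toTorus 1 x) *
              B (HSpCocycle.toTorus 2 x)) →
          HSpCocycle.IsFiberedRotationNumber α D
            (ρ - (((∑ i, (r i : ℝ) * α i) / 2 : ℝ) : UnitAddCircle))) := by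
  obtain ⟨f, hf⟩ := HSpCocycle.exists_isAngle hA
  obtain ⟨t, ht⟩ := hf.exists_tendsto hα
  have hc : ∀ p : ℝ, Continuous (HSpCocycle.toTorus p : (Fin d → ℝ) → HSpCocycle.Torus d p) :=
    fun p => (HSpCocycle.isOpenQuotientMap_toTorus p).continuous
  refine ⟨t, hf.isFiberedRotationNumber hm ht, fun B r hB => ?_, fun B r hB D hD => ?_⟩
  · obtain ⟨u, hu⟩ := hB.exists_arg
    refine hf.isFiberedRotationNumber_conj hm hα ht
      (B := B.comp ⟨HSpCocycle.toTorus 1, hc 1⟩) (β := fun i => r i)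
      (u := u.comp ⟨HSpCocycle.toTorus 1, hc 1⟩) (K := ‖u‖) (fun x => rfl)
      (fun x => u.norm_coe_le_norm _) (fun x => ?_)
    rw [HSpCocycle.expTwoPi_add, ← HSpCocycle.character_toTorus]
    exact hu _
  · obtain ⟨u, hu⟩ := hB.exists_arg
    have hhalf : Continuous fun x : Fin d → ℝ => HSpCocycle.toTorus 1 fun i => x i / 2 :=
      (hc 1).comp (by fun_prop)
    have hsum : (∑ i, (r i : ℝ) * α i) / 2 = ∑ i, ((r i : ℝ) / 2) * α i := by
      rw [Finset.sum_div]
      exact Finset.sum_congr rfl fun i _ => by ring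
    rw [hsum]
    -- The degree is that of `θ ↦ B (2θ)`; evaluating at `θ = x / 2` turns the character of `r` into
    -- the linear form with `β = r / 2`.
    refine hf.isFiberedRotationNumber_conj hm hα ht
      (B := B.comp ⟨HSpCocycle.toTorus 2, hc 2⟩) (β := fun i => r i / 2)
      (u := u.comp ⟨_, hhalf⟩) (K := ‖u‖) hD
      (fun x => u.norm_coe_le_norm _) (fun x => ?_)
    have h1 := hu (HSpCocycle.toTorus 1 fun i => x i / 2)
    rw [HSpCocycle.character_toTorus, ← HSpCocycle.expTwoPi_add] at h1
    have h2 : ∑ i, (r i : ℝ) * (x i / 2) = ∑ i, (r i : ℝ) / 2 * x i :=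
      Finset.sum_congr rfl fun i _ => by ring
    rw [h2, ContinuousMap.comp_apply, HSpCocycle.double_toTorus] at h1
    exact h1
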